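/- **Setting.** Let $0<T<\infty$, $\nu,\mu>0$, $m=\min\{\nu,\mu\}$, and let $c_0>0$. Let $(u,b)$ be a weak solution on $[0,T]$ of the three-dimensional Hall-MHD system $$u_t+u\cdot\nabla u-b\cdot\nabla b+\nabla \pi=\nu\Delta u,\qquad b_t+u\cdot\nabla b-b\cdot\nabla u+\nabla\times((\nabla\times b)\times b)=\mu\Delta b,\qquad \nabla\cdot u=0$$ on $\mathbb R^3$ with divergence-free data $u_0,b_0\in L^2(\mathbb R^3)$. That is, $u,b\in C_w([0,T];L^2)\cap L^2(0,T;H^1)$, $u(0)=u_0$, $b(0)=b_0$, the system holds in the sense of distributions, and $$\|u(t)\|_2^2+\|b(t)\|_2^2+2\nu\int_{t_0}^t\|\nabla u\|_2^2\,ds+2\mu\int_{t_0}^t\|\nabla b\|_2^2\,ds\le\|u(t_0)\|_2^2+\|b(t_0)\|_2^2$$ for almost every $t_0\in(0,T)$ and all $t\in(t_0,T]$. Let $\chi\in C_0^\infty(\mathbb R^3)$ be nonnegative and radial with $\chi(\xi)=1$ for $|\xi|\le\frac34$ and $\chi(\xi)=0$ for $|\xi|\ge1$. Put $\lambda_j=2^j$,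 $\varphi(\xi)=\chi(\xi/2)-\chi(\xi)$, $\Delta_jv=v_j=\mathcal F^{-1}(\varphi(\lambda_j^{-1}\cdot)\mathcal Fv)$ for $j\ge0$, $\Delta_{-1}v=v_{-1}=\mathcal F^{-1}(\chi\mathcal Fv)$, $v_{\le Q}=\sum_{j=-1}^Qv_j$, and $\|v\|_{B^s_{r,\infty}}=\sup_{j\ge-1}\lambda_j^s\|v_j\|_{L^r}$. For $t\in[0,T]$ let $Q_1(t)$, respectively $Q_2(t)$, be the least integer $j\ge0$ such that $$\lambda_k^{-1}\|u_k(t)\|_\infty<c_0m\ \text{ for all }k>j,\qquad\text{respectively}\qquad \|b_k(t)\|_\infty<c_0m\ \text{ for all }k>j,$$ and $\infty$ if there is no such $j$; $v_{\le\infty}=v$. Define $$f(t)=\|u_{\le Q_1(t)}(t)\|_{B^1_{\infty,\infty}}+\|\nabla b_{\le Q_2(t)}(t)\|_{B^1_{\infty,\infty}}.$$ **Lemma.** 1. If $u\in L^q(0,T;B^{-3/p}_{\infty,\infty})$ and $\nabla b\in L^\gamma(0,T;B^{-3/\beta}_{\infty,\infty})$ with $\frac2q+\frac3p=1$, $\frac2\gamma+\frac3\beta=1$,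 $q,\gamma\ge2$ and $p,\beta\in(3,\infty]$, then $Q_1(t)$ and $Q_2(t)$ are finite for almost every $t\in(0,T)$ and $f\in L^1(0,T)$. 2. The criterion $f\in L^1(0,T)$ is weaker than the Prodi–Serrin criterion: if $u\in L^q(0,T;L^p)$ and $\nabla b\in L^\gamma(0,T;L^\beta)$ with $\frac3p+\frac2q\le1$, $\frac3\beta+\frac2\gamma\le1$ and $p,\beta\in(3,\infty]$ (here $q,\gamma=\infty$ is allowed), then the conclusion of 1 holds. 3. The criterion $f\in L^1(0,T)$ is weaker than the BMO criterion: if $u,\nabla b\in L^2(0,T;\mathrm{BMO})$, then the conclusion of 1 holds. (For this it suffices that the BMO seminorms of $u(t)$ and $\nabla b(t)$ are in $L^2(0,T)$.) -/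

import Mathlib

open MeasureTheory Set Filter Topology
open scoped ENNReal SchwartzMap LineDeriv Distributions Matrix ContDiff

noncomputable section

namespace HallMHD

/-- Physical (and frequency) space `ℝ³`. -/
abbrev R3 : Type := EuclideanSpace ℝ (Fin 3)

/-- The standard basis vectors of `ℝ³`. -/
def e (i : Fin 3) : R3 := EuclideanSpace.single i 1

/-- Square integrable fields on `ℝ³` with real components indexed by `ι`. -/
abbrev L2Field (ι : Type) [Fintype ι] : Type :=
  Lp (EuclideanSpace ℝ ι) 2 (volume : Measure R3)

/-! ### Fields of tempered distributions -/

/-- A field of tempered distributions with components indexed by `ι`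
(`ι = Fin 3` for vector fields, `ι = Fin 3 × Fin 3` for their gradients). -/
abbrev DistField (ι : Type) : Type := ι → 𝓢'(R3, ℂ)

/-- The field of tempered distributions given by a square integrable field. -/
def fieldDist {ι : Type} [Fintype ι] (v : L2Field ι) : DistField ι := fun i =>
  Lp.toTemperedDistribution
    ((Complex.ofRealCLM.comp (EuclideanSpace.proj i : EuclideanSpace ℝ ι →L[ℝ] ℝ)).compLp v)

/-- The distributional gradient of a vector field: the entry `(i, j)` is `∂ᵢ Tⱼ`. -/
def gradDist (T : DistField (Fin 3)) : DistField (Fin 3 × Fin 3) :=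
  fun ij => ∂_{e ij.1} (T ij.2)

/-- The field of tempered distributions `T` is given by the locally integrable function `g`. -/
def Represents {ι : Type} [Fintype ι] (g : R3 → EuclideanSpace ℂ ι) (T : DistField ι) : Prop :=
  LocallyIntegrable g volume ∧
    ∀ (i : ι) (ψ : 𝓢(R3, ℂ)),
      Integrable (fun x => ψ x * g x i) volume ∧ T i ψ = ∫ x, ψ x * g x i

/-- The `L^r(ℝ³)` norm (`1 ≤ r ≤ ∞`, pointwise Euclidean norm) of a field of tempered
distributions. It is `∞` if the field is not given by a function in `L^r`. The representing
function is unique almost everywhere, so the infimum is over at most one value. -/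
def lebesgueNorm {ι : Type} [Fintype ι] (r : ℝ≥0∞) (T : DistField ι) : ℝ≥0∞ :=
  ⨅ (g : R3 → EuclideanSpace ℂ ι) (_ : Represents g T), eLpNorm g r volume

/-- The `BMO(ℝ³)` seminorm of a field of tempered distributions, `∞` if the field is not given
by a function: the supremum over all balls of the mean oscillation. -/
def bmoNorm {ι : Type} [Fintype ι] (T : DistField ι) : ℝ≥0∞ :=
  ⨅ (g : R3 → EuclideanSpace ℂ ι) (_ : Represents g T),
    ⨆ (x : R3) (r : ℝ) (_ : 0 < r),
      ⨍⁻ y in Metric.ball x r, ‖g y - (⨍ z in Metric.ball x r, g z ∂volume)‖ₑ ∂volume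

/-! ### Littlewood-Paley decomposition and Besov spaces -/

/-- The low frequency cut-off `χ` that generates the Littlewood-Paley decomposition. -/
structure IsCutoff (χ : R3 → ℝ) : Prop where
  smooth : ContDiff ℝ ∞ χ
  nonneg : ∀ ξ, 0 ≤ χ ξ
  radial : ∀ ξ η, ‖ξ‖ = ‖η‖ → χ ξ = χ η
  eq_one : ∀ ξ, ‖ξ‖ ≤ 3 / 4 → χ ξ = 1
  eq_zero : ∀ ξ, 1 ≤ ‖ξ‖ → χ ξ = 0

/-- The dyadic symbols: `φ(2^{-q} ξ)` with `φ(ξ) = χ(ξ/2) - χ(ξ)` for `q ≥ 0`, and `χ` for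
`q = -1`. (Indices below `-1` do not occur.) -/
def symbol (χ : R3 → ℝ) (q : ℤ) (ξ : R3) : ℝ :=
  if 0 ≤ q then
    χ ((2 : ℝ)⁻¹ • (((2 : ℝ) ^ q)⁻¹ • ξ)) - χ (((2 : ℝ) ^ q)⁻¹ • ξ)
  else if q = -1 then χ ξ
  else 0

/-- The Littlewood-Paley projection `Δ_q T = 𝓕⁻¹(φ_q 𝓕 T)`, componentwise. -/
def block {ι : Type} (χ : R3 → ℝ) (q : ℤ) (T : DistField ι) : DistField ι := fun i =>
  TemperedDistribution.fourierMultiplierCLM ℂ (fun ξ => (symbol χ q ξ : ℂ)) (T i)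

/-- The dyadic frequency `λ_q = 2^q`. -/
def lam (q : ℤ) : ℝ≥0∞ := (2 : ℝ≥0∞) ^ q

/-- The norm of the inhomogeneous Besov space `B^s_{r,∞}(ℝ³)`,
`sup_{q ≥ -1} λ_q^s ‖Δ_q T‖_r`. -/
def besovNorm {ι : Type} [Fintype ι] (χ : R3 → ℝ) (s : ℝ) (r : ℝ≥0∞) (T : DistField ι) :
    ℝ≥0∞ :=
  ⨆ (q : ℤ) (_ : -1 ≤ q), lam q ^ s * lebesgueNorm r (block χ q T)

/-- `T_{≤ Q} = ∑_{q = -1}^{Q} Δ_q T`, with `T_{≤ ∞} = T`. -/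
def lowFreq {ι : Type} (χ : R3 → ℝ) (Q : ℕ∞) (T : DistField ι) : DistField ι :=
  match Q with
  | (n : ℕ) => fun i => ∑ q ∈ Finset.Icc (-1 : ℤ) n, block χ q T i
  | ⊤ => T

/-! ### Dissipation wavenumbers -/

/-- The exponent `Q₁ ∈ ℕ ∪ {∞}` of the dissipation wavenumber `Λ₁ = 2^{Q₁}` of a velocity
field: the least `q ≥ 0` with `λ_p⁻¹ ‖u_p‖_∞ < κ` for all `p > q`, and `∞` if there is none.
Here `κ = c₀ m`. -/
def Q1 (χ : R3 → ℝ) (κ : ℝ) (u : DistField (Fin 3)) : ℕ∞ :=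
  ⨅ (q : ℕ) (_ : ∀ p : ℤ, (q : ℤ) < p →
    (lam p)⁻¹ * lebesgueNorm ⊤ (block χ p u) < ENNReal.ofReal κ), (q : ℕ∞)

/-- The exponent `Q₂ ∈ ℕ ∪ {∞}` of the dissipation wavenumber `Λ₂ = 2^{Q₂}` of a magnetic
field: the least `q ≥ 0` with `‖b_p‖_∞ < κ` for all `p > q`, and `∞` if there is none. -/
def Q2 (χ : R3 → ℝ) (κ : ℝ) (b : DistField (Fin 3)) : ℕ∞ :=
  ⨅ (q : ℕ) (_ : ∀ p : ℤ, (q : ℤ) < p →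
    lebesgueNorm ⊤ (block χ p b) < ENNReal.ofReal κ), (q : ℕ∞)

/-- `f(t) = ‖u_{≤ Q₁(t)}(t)‖_{B^1_{∞,∞}} + ‖∇b_{≤ Q₂(t)}(t)‖_{B^1_{∞,∞}}`. -/
def lowModes (χ : R3 → ℝ) (κ : ℝ) (u b : ℝ → L2Field (Fin 3)) (t : ℝ) : ℝ≥0∞ :=
  besovNorm χ 1 ⊤ (lowFreq χ (Q1 χ κ (fieldDist (u t))) (fieldDist (u t))) +
    besovNorm χ 1 ⊤ (gradDist (lowFreq χ (Q2 χ κ (fieldDist (b t))) (fieldDist (b t))))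

/-- `f ∈ L¹(0,T)`, where the wavenumbers that enter the definition of `f` are finite for almost
every time. -/
def LowModesIntegrable (χ : R3 → ℝ) (κ T : ℝ) (u b : ℝ → L2Field (Fin 3)) : Prop :=
  (∀ᵐ t ∂(volume.restrict (Ioo 0 T)),
      Q1 χ κ (fieldDist (u t)) ≠ ⊤ ∧ Q2 χ κ (fieldDist (b t)) ≠ ⊤) ∧
    Integrable (lowModes χ κ u b) (volume.restrict (Ioo 0 T))

/-! ### Weak solutions of the Hall-MHD system -/

/-- `v ∈ C_w([0,T]; L²) ∩ L²(0,T; H¹)`, with `g` the spatial gradient of `v`. -/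
structure InEnergyClass (T : ℝ) (v : ℝ → L2Field (Fin 3)) (g : ℝ → L2Field (Fin 3 × Fin 3)) :
    Prop where
  weakCont : ∀ w : L2Field (Fin 3), ContinuousOn (fun t => inner ℝ (v t) w) (Icc 0 T)
  memL2 : MemLp v 2 (volume.restrict (Ioo 0 T))
  memL2_grad : MemLp g 2 (volume.restrict (Ioo 0 T))
  grad_eq : ∀ᵐ t ∂(volume.restrict (Ioo 0 T)), fieldDist (g t) = gradDist (fieldDist (v t))

/-- The divergence of a vector field vanishes in the sense of distributions. -/
def DivFree (v : L2Field (Fin 3)) : Prop :=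
  ∑ i : Fin 3, gradDist (fieldDist v) (i, i) = 0

/-- The open space-time domain `(0,T) × ℝ³`. -/
def spaceTime (T : ℝ) : TopologicalSpace.Opens (ℝ × R3) :=
  ⟨Ioo 0 T ×ˢ univ, isOpen_Ioo.prod isOpen_univ⟩

/-- Time derivative of a test function. -/
def dt {T : ℝ} (ψ : 𝓓(spaceTime T, ℝ)) : 𝓓(spaceTime T, ℝ) := ∂_{((1 : ℝ), (0 : R3))} ψ

/-- Spatial derivative of a test function in the direction of the `i`-th coordinate. -/
def dx {T : ℝ} (i : Fin 3) (ψ : 𝓓(spaceTime T, ℝ)) : 𝓓(spaceTime T, ℝ) :=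
  ∂_{((0 : ℝ), e i)} ψ

/-- The curl of a vector field with gradient matrix `G (i, j) = ∂ᵢ vⱼ`. -/
def curlOf (G : EuclideanSpace ℝ (Fin 3 × Fin 3)) : Fin 3 → ℝ :=
  ![G (1, 2) - G (2, 1), G (2, 0) - G (0, 2), G (0, 1) - G (1, 0)]

/-- The `j`-th component of `(v · ∇) w`, where `G` is the gradient matrix of `w`. -/
def advect (v : R3) (G : EuclideanSpace ℝ (Fin 3 × Fin 3)) (j : Fin 3) : ℝ :=
  ∑ i : Fin 3, v i * G (i, j)

/-- The equation `u_t + u·∇u - b·∇b + ∇p = ν Δu` in the sense of distributions on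
`(0,T) × ℝ³`, for some scalar distribution `p`. -/
def MomentumEq (ν T : ℝ) (u b : ℝ → L2Field (Fin 3)) (gu gb : ℝ → L2Field (Fin 3 × Fin 3)) :
    Prop :=
  ∃ p : 𝓓'(spaceTime T, ℝ), ∀ (j : Fin 3) (ψ : 𝓓(spaceTime T, ℝ)),
    (∫ t in Ioo 0 T, ∫ x : R3,
      (-(u t x j * dt ψ (t, x)) + advect (u t x) (gu t x) j * ψ (t, x)
        - advect (b t x) (gb t x) j * ψ (t, x)
        - ν * (u t x j * ∑ k : Fin 3, dx k (dx k ψ) (t, x)))) = p (dx j ψ)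

/-- The equation `b_t + u·∇b - b·∇u + ∇×((∇×b)×b) = μ Δb` in the sense of distributions on
`(0,T) × ℝ³`. The curl in front of the Hall term `H = (∇×b)×b` is moved to the test function:
the `j`-th component of `∇×H` tested with `ψ` is the `j`-th component of `∫ H × ∇ψ`. -/
def InductionEq (μ T : ℝ) (u b : ℝ → L2Field (Fin 3)) (gu gb : ℝ → L2Field (Fin 3 × Fin 3)) :
    Prop :=
  ∀ (j : Fin 3) (ψ : 𝓓(spaceTime T, ℝ)),
    (∫ t in Ioo 0 T, ∫ x : R3,
      (-(b t x j * dt ψ (t, x)) + advect (u t x) (gb t x) j * ψ (t, x)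
        - advect (b t x) (gu t x) j * ψ (t, x)
        + ((curlOf (gb t x) ⨯₃ (fun i => b t x i)) ⨯₃ (fun i => dx i ψ (t, x))) j
        - μ * (b t x j * ∑ k : Fin 3, dx k (dx k ψ) (t, x)))) = 0

/-- The energy inequality, for almost all initial times `t₀ ∈ (0,T)` and all `t ∈ (t₀,T]`. -/
def EnergyIneq (ν μ T : ℝ) (u b : ℝ → L2Field (Fin 3))
    (gu gb : ℝ → L2Field (Fin 3 × Fin 3)) : Prop :=
  ∀ᵐ t₀ ∂(volume.restrict (Ioo 0 T)), ∀ t ∈ Ioc t₀ T,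
    ‖u t‖ ^ 2 + ‖b t‖ ^ 2 + 2 * ν * (∫ s in t₀..t, ‖gu s‖ ^ 2) + 2 * μ * (∫ s in t₀..t, ‖gb s‖ ^ 2)
      ≤ ‖u t₀‖ ^ 2 + ‖b t₀‖ ^ 2

/-- `(u, b)` is a weak solution on `[0,T]` of the three dimensional Hall-MHD system with
viscosity `ν`, magnetic resistivity `μ` and initial data `(u₀, b₀)`. -/
def IsWeakSolution (ν μ T : ℝ) (u₀ b₀ : L2Field (Fin 3)) (u b : ℝ → L2Field (Fin 3)) : Prop :=
  u 0 = u₀ ∧ b 0 = b₀ ∧ DivFree u₀ ∧ DivFree b₀ ∧ (∀ t ∈ Icc 0 T, DivFree (u t)) ∧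
    ∃ gu gb : ℝ → L2Field (Fin 3 × Fin 3),
      InEnergyClass T u gu ∧ InEnergyClass T b gb ∧
        MomentumEq ν T u b gu gb ∧ InductionEq μ T u b gu gb ∧ EnergyIneq ν μ T u b gu gb

/-- The scalar function of time `N` (a spatial norm) lies in `L^q(0,T)`. -/
def InLq (T : ℝ) (q : ℝ≥0∞) (N : ℝ → ℝ≥0∞) : Prop :=
  MemLp N q (volume.restrict (Ioo 0 T))

end HallMHD

end

open HallMHD

namespace HallMHD

open scoped FourierTransform

variable {ι : Type} [Fintype ι]

/-! The velocity and the magnetic part are the same one-field problem. Let `g` be `u` or `∇b`, `a_j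
= ‖Δ_j g‖_∞` and `N = ‖g‖_{B^{-s}_{∞,∞}}` with `0 ≤ s < 1`, so that `a_j ≤ λ_j^s N`. The quantity
`d_j` that defines the wavenumber satisfies `d_j ≤ C λ_j⁻¹ a_j`: trivially for `u`, and for `b` by
the inverse Bernstein inequality `λ_j ‖b_j‖_∞ ≤ C ‖Δ_j ∇b‖_∞`. Hence `d_j ≤ C N λ_j^{s-1} → 0` and
`Q` is finite whenever `N` is. If `Q ≥ 1`, minimality gives `κ ≤ d_Q`, so `λ_Q^{1-s} ≤ C N / κ`, and
for `j ≤ Q` `λ_j a_j ≤ λ_Q^{1+s} N ≤ C N^{(1+s)/(1-s)+1} = C N^{2/(1-s)}`. With `s = 3/p` the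
exponent `2/(1-s)` is exactly `q`, so integrating in time gives part 1. This is
`exists_lam_mul_le_of_threshold`, integrated in `lowModes_field`.

Parts 2 and 3 reduce to the same bound. Bernstein's inequality embeds `L^p` into `B^{-3/p}_{∞,∞}`,
and the finite time interval absorbs any surplus in the time exponent. For BMO take `s = 0`: the
blocks `j ≥ 0` have kernels of mean zero and are bounded by the seminorm, while block `-1` is
bounded by the `L²` norm from the energy class.

Measurability of `f` rests on two facts: `v ↦ ‖m(D) v‖_∞` is Lipschitz on `L²` for Schwartz `m`, and
the wavenumber exponents take countably many values. -/

/-! ### Fourier multipliers as convolutions, and Young's inequality. -/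

/-- A multiplier acts on a distribution through its transpose on test functions; this computes the
transpose as convolution with the reflected kernel. The product `m · 𝓕⁻ψ` is a product of two
Fourier transforms because `𝓕⁻𝓕⁻ψ` is the reflection of `ψ`. -/
theorem fourier_smulLeft_fourierInv_apply (m ψ : 𝓢(R3, ℂ)) (y : R3) :
    (𝓕 (SchwartzMap.smulLeftCLM ℂ (m : R3 → ℂ) (𝓕⁻ ψ)) : 𝓢(R3, ℂ)) y =
      ∫ x, (𝓕⁻ m : 𝓢(R3, ℂ)) (x - y) * ψ x := by
  have h1 : ∀ (h : 𝓢(R3, ℂ)) (z : R3), (𝓕⁻ h : 𝓢(R3, ℂ)) z = (𝓕 h : 𝓢(R3, ℂ)) (-z) := by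
    intro h z
    rw [SchwartzMap.fourierInv_coe, SchwartzMap.fourier_coe, Real.fourierInv_eq_fourier_neg]
  have h2 : ∀ z, (𝓕⁻ (𝓕⁻ ψ) : 𝓢(R3, ℂ)) z = ψ (-z) := by
    intro z
    rw [h1, FourierTransform.fourier_fourierInv_eq]
  have h3 : SchwartzMap.smulLeftCLM ℂ (m : R3 → ℂ) (𝓕⁻ ψ) =
      SchwartzMap.pairing (ContinuousLinearMap.mul ℂ ℂ) (𝓕 (𝓕⁻ m)) (𝓕 (𝓕⁻ (𝓕⁻ ψ))) := by
    ext x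
    simp [SchwartzMap.smulLeftCLM_apply_apply m.hasTemperateGrowth, SchwartzMap.pairing_apply_apply]
  have h4 : (𝓕 (SchwartzMap.smulLeftCLM ℂ (m : R3 → ℂ) (𝓕⁻ ψ)) : 𝓢(R3, ℂ)) y =
      SchwartzMap.convolution (ContinuousLinearMap.mul ℂ ℂ) (𝓕⁻ m) (𝓕⁻ (𝓕⁻ ψ)) (-y) := by
    rw [← neg_neg y, ← h1, neg_neg, h3, ← SchwartzMap.fourier_convolution,
      FourierTransform.fourierInv_fourier_eq]
  rw [h4, SchwartzMap.convolution_apply, MeasureTheory.convolution_def]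
  rw [← integral_sub_right_eq_self _ y]
  refine integral_congr_ae (Eventually.of_forall fun x => ?_)
  simp [h2]

/-- The convolution of a scalar kernel with a field. -/
noncomputable def kernelConv (K : R3 → ℂ) (g : R3 → EuclideanSpace ℂ ι) (x : R3) :
    EuclideanSpace ℂ ι :=
  ∫ y, K (x - y) • g y

/-- The Fourier multiplier with symbol `m`, acting componentwise. -/
noncomputable def fieldMult {ι : Type} (m : R3 → ℂ) (T : DistField ι) : DistField ι := fun i =>
  TemperedDistribution.fourierMultiplierCLM ℂ m (T i)

theorem eLpNorm_comp_sub_left {p : ℝ≥0∞} {E : Type*} [NormedAddCommGroup E] {K : R3 → E}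
    (hK : AEStronglyMeasurable K volume) (x : R3) :
    eLpNorm (fun y => K (x - y)) p volume = eLpNorm K p volume :=
  eLpNorm_comp_measurePreserving hK (Measure.measurePreserving_sub_left volume x)

theorem lintegral_kernelConv_le {p p' : ℝ≥0∞} [ENNReal.HolderConjugate p' p] {K : R3 → ℂ}
    (hK : AEStronglyMeasurable K volume) {g : R3 → EuclideanSpace ℂ ι}
    (hg : AEStronglyMeasurable g volume) (x : R3) :
    ∫⁻ y, ‖K (x - y) • g y‖ₑ ≤ eLpNorm K p' volume * eLpNorm g p volume := by
  have hK' : AEStronglyMeasurable (fun y => K (x - y)) volume :=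
    hK.comp_measurePreserving (Measure.measurePreserving_sub_left volume x)
  have := eLpNorm_le_eLpNorm_mul_eLpNorm_of_nnnorm (p := p') (q := p) (r := 1) hK' hg
    (fun a b => a • b) 1 (Eventually.of_forall fun y => by simp [nnnorm_smul])
  rwa [eLpNorm_one_eq_lintegral_enorm, ENNReal.coe_one, one_mul, eLpNorm_comp_sub_left hK] at this

theorem enorm_kernelConv_le {p p' : ℝ≥0∞} [ENNReal.HolderConjugate p' p] {K : R3 → ℂ}
    (hK : AEStronglyMeasurable K volume) {g : R3 → EuclideanSpace ℂ ι}
    (hg : AEStronglyMeasurable g volume) (x : R3) :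
    ‖kernelConv K g x‖ₑ ≤ eLpNorm K p' volume * eLpNorm g p volume :=
  (enorm_integral_le_lintegral_enorm _).trans (lintegral_kernelConv_le hK hg x)

theorem aestronglyMeasurable_kernel_prod {K : R3 → ℂ} (hK : Continuous K)
    {g : R3 → EuclideanSpace ℂ ι} (hg : AEStronglyMeasurable g volume) :
    AEStronglyMeasurable (fun z : R3 × R3 => K (z.1 - z.2) • g z.2) (volume.prod volume) :=
  AEStronglyMeasurable.smul (hK.comp (continuous_fst.sub continuous_snd)).aestronglyMeasurable
    hg.comp_snd

theorem aestronglyMeasurable_kernelConv {K : R3 → ℂ} (hK : Continuous K)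
    {g : R3 → EuclideanSpace ℂ ι} (hg : AEStronglyMeasurable g volume) :
    AEStronglyMeasurable (kernelConv K g) volume :=
  (aestronglyMeasurable_kernel_prod hK hg).integral_prod_right'

theorem Represents.lebesgueNorm_le {r : ℝ≥0∞} {g : R3 → EuclideanSpace ℂ ι} {T : DistField ι}
    (hg : Represents g T) : lebesgueNorm r T ≤ eLpNorm g r volume :=
  iInf₂_le (f := fun (g : R3 → EuclideanSpace ℂ ι) (_ : Represents g T) => eLpNorm g r volume) g hg

theorem Represents.of_memLp {p : ℝ≥0∞} (hp : 1 ≤ p) {g : R3 → EuclideanSpace ℂ ι}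
    (hg : MemLp g p volume) {T : DistField ι}
    (hT : ∀ (i : ι) (ψ : 𝓢(R3, ℂ)), T i ψ = ∫ x, ψ x * g x i) : Represents g T := by
  refine ⟨hg.locallyIntegrable hp, fun i ψ => ⟨?_, hT i ψ⟩⟩
  have hi : MemLp (fun x => g x i) p volume :=
    hg.continuousLinearMap_comp (EuclideanSpace.proj i : EuclideanSpace ℂ ι →L[ℂ] ℂ)
  have := ENNReal.HolderConjugate.inv_one_sub_inv' hp
  have : ENNReal.HolderConjugate (1 - p⁻¹)⁻¹ p := ENNReal.HolderConjugate.symm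
  exact (ψ.memLp ((1 - p⁻¹)⁻¹) volume).integrable_mul hi

/-- A Fourier multiplier with Schwartz symbol acts on `L^p` fields by convolution with its
kernel. -/
theorem Represents.kernelConv {p : ℝ≥0∞} (hp : 1 ≤ p) {g : R3 → EuclideanSpace ℂ ι}
    {T : DistField ι} (hT : Represents g T) (hg : MemLp g p volume) (m : 𝓢(R3, ℂ)) :
    Represents (kernelConv (𝓕⁻ m : 𝓢(R3, ℂ)) g) (fieldMult m T) := by
  set K : 𝓢(R3, ℂ) := 𝓕⁻ m with hK
  -- The formula `(1 - p⁻¹)⁻¹` for the conjugate exponent covers `p = 1` and `p = ∞` as well.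
  have := ENNReal.HolderConjugate.inv_one_sub_inv' hp
  have : ENNReal.HolderConjugate (1 - p⁻¹)⁻¹ p := ENNReal.HolderConjugate.symm
  set p' : ℝ≥0∞ := (1 - p⁻¹)⁻¹
  have hKp : eLpNorm K p' volume < ⊤ := (K.memLp p' volume).2
  set A : ℝ≥0∞ := eLpNorm K p' volume * eLpNorm g p volume with hA
  have hA' : A < ⊤ := ENNReal.mul_lt_top hKp hg.2
  have hbd : ∀ x, ∫⁻ y, ‖K (x - y) • g y‖ₑ ≤ A := fun x =>
    lintegral_kernelConv_le K.continuous.aestronglyMeasurable hg.1 x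
  have hint : ∀ x, Integrable (fun y => K (x - y) • g y) volume := fun x =>
    ⟨AEStronglyMeasurable.smul
      (K.continuous.comp (continuous_const.sub continuous_id)).aestronglyMeasurable hg.1,
      (hbd x).trans_lt hA'⟩
  have hmem : MemLp (HallMHD.kernelConv K g) ⊤ volume :=
    ⟨aestronglyMeasurable_kernelConv K.continuous hg.1, by
      rw [eLpNorm_exponent_top]
      refine (essSup_le_of_ae_le A (Eventually.of_forall fun x => ?_)).trans_lt hA'
      exact enorm_kernelConv_le K.continuous.aestronglyMeasurable hg.1 x⟩
  refine Represents.of_memLp le_top hmem fun i ψ => ?_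
  have hcomp : ∀ x, HallMHD.kernelConv K g x i = ∫ y, K (x - y) * g y i := fun x =>
    ((EuclideanSpace.proj i : EuclideanSpace ℂ ι →L[ℂ] ℂ).integral_comp_comm (hint x)).symm
  -- Fubini is justified by Hölder's bound `A` on the inner integral, uniform in `x`, against the
  -- integrable `ψ`.
  have hF : Integrable (Function.uncurry fun x y => ψ x * (K (x - y) * g y i))
      (volume.prod volume) := by
    have hm : AEStronglyMeasurable (fun z : R3 × R3 => ψ z.1 • (K (z.1 - z.2) • g z.2))
        (volume.prod volume) :=
      AEStronglyMeasurable.smul (ψ.continuous.comp continuous_fst).aestronglyMeasurable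
        (aestronglyMeasurable_kernel_prod K.continuous hg.1)
    have hI : Integrable (fun z : R3 × R3 => ψ z.1 • (K (z.1 - z.2) • g z.2))
        (volume.prod volume) := by
      refine ⟨hm, ?_⟩
      rw [HasFiniteIntegral, lintegral_prod _ hm.enorm]
      calc ∫⁻ x, ∫⁻ y, ‖ψ x • (K (x - y) • g y)‖ₑ
          ≤ ∫⁻ x, ‖ψ x‖ₑ * A := by
            refine lintegral_mono fun x => ?_
            simp_rw [enorm_smul (ψ x)]
            rw [lintegral_const_mul'' _ (hint x).1.enorm]
            gcongr
            exact hbd x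
        _ = (∫⁻ x, ‖ψ x‖ₑ) * A := lintegral_mul_const' _ _ hA'.ne
        _ < ⊤ := ENNReal.mul_lt_top ψ.integrable.2 hA'
    exact (EuclideanSpace.proj i : EuclideanSpace ℂ ι →L[ℂ] ℂ).integrable_comp hI
  calc fieldMult m T i ψ
      = T i (𝓕 (SchwartzMap.smulLeftCLM ℂ (m : R3 → ℂ) (𝓕⁻ ψ))) := rfl
    _ = ∫ y, (∫ x, K (x - y) * ψ x) * g y i := by
        rw [(hT.2 i _).2]
        simp_rw [fourier_smulLeft_fourierInv_apply]
        rfl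
    _ = ∫ y, ∫ x, ψ x * (K (x - y) * g y i) := by
        congr 1; ext y
        rw [← integral_mul_const]
        congr 1; ext x; ring
    _ = ∫ x, ∫ y, ψ x * (K (x - y) * g y i) := (integral_integral_swap hF).symm
    _ = ∫ x, ψ x * HallMHD.kernelConv K g x i := by
        congr 1; ext x
        rw [integral_const_mul, hcomp]

/-- Young's inequality `‖m(D) T‖_∞ ≤ ‖𝓕⁻¹ m‖_{p'} ‖T‖_p`. -/
theorem lebesgueNorm_fieldMult_le {p p' : ℝ≥0∞} (hp : 1 ≤ p) [ENNReal.HolderConjugate p' p]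
    (m : 𝓢(R3, ℂ)) {C : ℝ≥0∞} (hC : C ≠ 0)
    (hCt : C ≠ ⊤) (hm : eLpNorm (𝓕⁻ m : 𝓢(R3, ℂ)) p' volume ≤ C) (T : DistField ι) :
    lebesgueNorm ⊤ (fieldMult m T) ≤ C * lebesgueNorm p T := by
  rw [lebesgueNorm.eq_def p]
  simp_rw [ENNReal.mul_iInf_of_ne hC hCt]
  refine le_iInf fun g => le_iInf fun hg => ?_
  -- `C ≠ 0` matters here, since `0 * ⊤ = 0`; later constants get `+ 1` for this reason.
  by_cases hgt : eLpNorm g p volume = ⊤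
  · rw [hgt, ENNReal.mul_top hC]; exact le_top
  have hgm : MemLp g p volume := ⟨hg.1.aestronglyMeasurable, lt_top_iff_ne_top.2 hgt⟩
  refine (hg.kernelConv hp hgm m).lebesgueNorm_le.trans ?_
  rw [eLpNorm_exponent_top]
  refine essSup_le_of_ae_le (C * eLpNorm g p volume) (Eventually.of_forall fun x => ?_)
  refine (enorm_kernelConv_le (p := p) (p' := p')
    (𝓕⁻ m : 𝓢(R3, ℂ)).continuous.aestronglyMeasurable hgm.1 x).trans ?_
  exact mul_le_mul_left hm _

/-! ### Uniqueness of representatives and subadditivity of the norm. -/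

theorem Represents.ae_eq {T : DistField ι} {g h : R3 → EuclideanSpace ℂ ι}
    (hg : Represents g T) (hh : Represents h T) : g =ᵐ[volume] h := by
  have key : ∀ i, ∀ᵐ x ∂(volume : Measure R3), g x i = h x i := by
    intro i
    have hl : ∀ {f : R3 → EuclideanSpace ℂ ι}, LocallyIntegrable f volume →
        LocallyIntegrable (fun x => f x i) volume := fun hf x =>
      let ⟨s, hs, hi⟩ := hf x
      ⟨s, hs, (EuclideanSpace.proj i : EuclideanSpace ℂ ι →L[ℂ] ℂ).integrable_comp hi⟩
    refine ae_eq_of_integral_contDiff_smul_eq (hl hg.1) (hl hh.1) fun φ hφ hc => ?_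
    have h₁ : HasCompactSupport (Complex.ofRealCLM ∘ φ) := hc.comp_left rfl
    have h₂ : ContDiff ℝ ∞ (Complex.ofRealCLM ∘ φ) := by fun_prop
    have e1 := (hg.2 i (h₁.toSchwartzMap h₂)).2
    have e2 := (hh.2 i (h₁.toSchwartzMap h₂)).2
    simpa using e1.symm.trans e2
  filter_upwards [ae_all_iff.2 key] with x hx
  ext i
  exact hx i

theorem Represents.add {S T : DistField ι} {g h : R3 → EuclideanSpace ℂ ι}
    (hg : Represents g S) (hh : Represents h T) : Represents (g + h) (S + T) := by
  refine ⟨hg.1.add hh.1, fun i ψ => ?_⟩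
  obtain ⟨hg1, hg2⟩ := hg.2 i ψ
  obtain ⟨hh1, hh2⟩ := hh.2 i ψ
  have : (fun x => ψ x * (g + h) x i) = fun x => ψ x * g x i + ψ x * h x i := by
    ext x; simp [mul_add]
  rw [this]
  refine ⟨hg1.add hh1, ?_⟩
  rw [integral_add hg1 hh1, ← hg2, ← hh2]
  rfl

theorem lebesgueNorm_zero (r : ℝ≥0∞) : lebesgueNorm r (0 : DistField ι) = 0 := by
  refine le_antisymm (iInf₂_le_of_le 0 ⟨locallyIntegrable_zero, fun i ψ => ?_⟩ ?_) bot_le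
  · simp
  · simp

theorem lebesgueNorm_add_le {r : ℝ≥0∞} (hr : 1 ≤ r) (S T : DistField ι) :
    lebesgueNorm r (S + T) ≤ lebesgueNorm r S + lebesgueNorm r T := by
  unfold lebesgueNorm
  refine ENNReal.le_iInf₂_add_iInf₂ fun g hg h hh => ?_
  exact (hg.add hh).lebesgueNorm_le.trans
    (eLpNorm_add_le hg.1.aestronglyMeasurable hh.1.aestronglyMeasurable hr)

theorem lebesgueNorm_sum_le {r : ℝ≥0∞} (hr : 1 ≤ r) {κ : Type*} (s : Finset κ)
    (T : κ → DistField ι) :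
    lebesgueNorm r (∑ k ∈ s, T k) ≤ ∑ k ∈ s, lebesgueNorm r (T k) :=
  Finset.le_sum_of_subadditive _ (lebesgueNorm_zero r).le (lebesgueNorm_add_le hr) _ _

/-- Selecting components does not increase the norm. -/
theorem lebesgueNorm_comp_le {κ : Type} [Fintype κ] (r : ℝ≥0∞) {c : κ → ι}
    (hc : Function.Injective c) (T : DistField ι) :
    lebesgueNorm r (fun k => T (c k)) ≤ lebesgueNorm r T := by
  refine le_iInf₂ fun g hg => ?_
  let P : EuclideanSpace ℂ ι →L[ℂ] EuclideanSpace ℂ κ :=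
    (EuclideanSpace.equiv κ ℂ).symm.toContinuousLinearMap ∘L
      ContinuousLinearMap.pi fun k => EuclideanSpace.proj (c k)
  have hP : ∀ v k, P v k = v (c k) := fun v k => rfl
  have hle : ∀ v, ‖P v‖ ≤ ‖v‖ := by
    intro v
    rw [EuclideanSpace.norm_eq, EuclideanSpace.norm_eq]
    refine Real.sqrt_le_sqrt ?_
    simp_rw [hP]
    calc ∑ k, ‖v (c k)‖ ^ 2 = ∑ i ∈ Finset.univ.map ⟨c, hc⟩, ‖v i‖ ^ 2 := by
          rw [Finset.sum_map]; rfl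
      _ ≤ ∑ i, ‖v i‖ ^ 2 :=
          Finset.sum_le_sum_of_subset_of_nonneg (Finset.subset_univ _) fun _ _ _ => by positivity
  refine iInf₂_le_of_le (fun x => P (g x)) ⟨fun x => ?_, fun k ψ => hg.2 (c k) ψ⟩ ?_
  · obtain ⟨s, hs, hi⟩ := hg.1 x
    exact ⟨s, hs, P.integrable_comp hi⟩
  · exact eLpNorm_mono fun x => hle _

theorem fieldMult_add {ι : Type} (m : R3 → ℂ) (S T : DistField ι) :
    fieldMult m (S + T) = fieldMult m S + fieldMult m T := by
  ext i : 1
  exact map_add _ _ _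

theorem fieldMult_sum {ι κ : Type} (m : R3 → ℂ) (s : Finset κ) (T : κ → DistField ι) :
    fieldMult m (∑ k ∈ s, T k) = ∑ k ∈ s, fieldMult m (T k) := by
  ext i : 1
  simp [fieldMult, Finset.sum_apply, map_sum]

/-! ### Square integrable fields as distributions. -/

/-- The complex valued function given by a real square integrable field. -/
noncomputable def complexify (v : L2Field ι) (x : R3) : EuclideanSpace ℂ ι :=
  WithLp.toLp 2 fun i => (v x i : ℂ)

theorem norm_complexify (v : L2Field ι) (x : R3) : ‖complexify v x‖ = ‖v x‖ := by
  simp [EuclideanSpace.norm_eq, complexify]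

theorem eLpNorm_complexify (v : L2Field ι) (p : ℝ≥0∞) :
    eLpNorm (complexify v) p volume = eLpNorm v p volume :=
  eLpNorm_congr_norm_ae (Eventually.of_forall (norm_complexify v))

theorem memLp_complexify (v : L2Field ι) : MemLp (complexify v) 2 volume := by
  refine ⟨?_, by rw [eLpNorm_complexify]; exact (Lp.memLp v).2⟩
  let J : EuclideanSpace ℝ ι →L[ℝ] EuclideanSpace ℂ ι :=
    (EuclideanSpace.equiv ι ℂ).symm.toContinuousLinearMap.restrictScalars ℝ ∘L
      ContinuousLinearMap.pi fun i => Complex.ofRealCLM ∘L EuclideanSpace.proj i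
  exact J.continuous.comp_aestronglyMeasurable (Lp.aestronglyMeasurable v)

theorem represents_fieldDist (v : L2Field ι) : Represents (complexify v) (fieldDist v) := by
  refine Represents.of_memLp one_le_two (memLp_complexify v) fun i ψ => ?_
  rw [fieldDist, Lp.toTemperedDistribution_apply]
  refine integral_congr_ae ?_
  filter_upwards [(Complex.ofRealCLM.comp
    (EuclideanSpace.proj i : EuclideanSpace ℝ ι →L[ℝ] ℝ)).coeFn_compLp v] with x hx
  rw [hx]
  rfl

theorem fieldDist_add (v w : L2Field ι) : fieldDist (v + w) = fieldDist v + fieldDist w := by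
  ext i : 1
  have h := ((Complex.ofRealCLM.comp
    (EuclideanSpace.proj i : EuclideanSpace ℝ ι →L[ℝ] ℝ)).compLpL 2 (volume : Measure R3)).map_add
      v w
  simp only [fieldDist, Pi.add_apply]
  exact (congrArg (Lp.toTemperedDistributionCLM ℂ volume 2) h).trans
    (map_add (Lp.toTemperedDistributionCLM ℂ volume 2) _ _)

theorem lebesgueNorm_fieldDist_le (v : L2Field ι) (p : ℝ≥0∞) :
    lebesgueNorm p (fieldDist v) ≤ eLpNorm v p volume :=
  (represents_fieldDist v).lebesgueNorm_le.trans (eLpNorm_complexify v p).le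

/-- `v ↦ ‖m(D) v‖_∞` is continuous on `L²`. -/
theorem continuous_lebesgueNorm_fieldMult (m : 𝓢(R3, ℂ)) :
    Continuous fun v : L2Field ι => lebesgueNorm ⊤ (fieldMult m (fieldDist v)) := by
  set C : ℝ≥0∞ := eLpNorm (𝓕⁻ m : 𝓢(R3, ℂ)) 2 volume + 1 with hC
  have hCt : C ≠ ⊤ := ENNReal.add_ne_top.2 ⟨((𝓕⁻ m : 𝓢(R3, ℂ)).memLp 2 volume).2.ne, by simp⟩
  -- Lipschitz continuity: subadditivity reduces to `v - w`, which Young's inequality with `p = p' =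
  -- 2` controls.
  refine continuous_of_le_add_edist C hCt fun v w => ?_
  have : fieldDist v = fieldDist w + fieldDist (v - w) := by
    rw [← fieldDist_add, add_sub_cancel]
  rw [this, fieldMult_add]
  refine (lebesgueNorm_add_le le_top _ _).trans ?_
  gcongr
  refine (lebesgueNorm_fieldMult_le (p := 2) (p' := 2) one_le_two m (by simp [hC]) hCt
    le_self_add _).trans ?_
  gcongr
  refine (lebesgueNorm_fieldDist_le _ _).trans ?_
  rw [edist_eq_enorm_sub, Lp.enorm_def]

/-! ### Dilations and Bernstein's inequality. -/

/-- Dilation of a Schwartz symbol: `ξ ↦ m (ξ / r)`. -/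
noncomputable def dilate (r : ℝ) (hr : r ≠ 0) (m : 𝓢(R3, ℂ)) : 𝓢(R3, ℂ) :=
  SchwartzMap.compCLMOfContinuousLinearEquiv ℂ
    (ContinuousLinearEquiv.smulLeft (Units.mk0 r⁻¹ (inv_ne_zero hr)) : R3 ≃L[ℝ] R3) m

@[simp]
theorem dilate_apply (r : ℝ) (hr : r ≠ 0) (m : 𝓢(R3, ℂ)) (ξ : R3) :
    dilate r hr m ξ = m (r⁻¹ • ξ) := rfl

theorem fourierInv_dilate_apply {r : ℝ} (hr : 0 < r) (m : 𝓢(R3, ℂ)) (x : R3) :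
    (𝓕⁻ (dilate r hr.ne' m) : 𝓢(R3, ℂ)) x = (r ^ 3 : ℝ) • (𝓕⁻ m : 𝓢(R3, ℂ)) (r • x) := by
  rw [SchwartzMap.fourierInv_coe, SchwartzMap.fourierInv_coe, Real.fourierInv_eq,
    Real.fourierInv_eq]
  have := Measure.integral_comp_smul (volume : Measure R3)
    (fun ξ => Real.fourierChar (inner ℝ ξ (r • x)) • m ξ) r⁻¹
  simp only [finrank_euclideanSpace, Fintype.card_fin, inv_pow, inv_inv] at this
  rw [abs_of_pos (by positivity)] at this
  rw [← this]
  congr 1; ext ξ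
  rw [inner_smul_left, inner_smul_right, dilate_apply]
  simp [hr.ne']

theorem eLpNorm_comp_smul {r : ℝ} (hr : 0 < r) {E : Type*} [NormedAddCommGroup E] {K : R3 → E}
    (hK : Continuous K) (p : ℝ≥0∞) :
    eLpNorm (fun x => K (r • x)) p volume =
      ENNReal.ofReal r ^ (-3 * (p⁻¹).toReal) * eLpNorm K p volume := by
  have hm := Measure.map_addHaar_smul (volume : Measure R3) hr.ne'
  have h1 : eLpNorm (fun x => K (r • x)) p volume =
      eLpNorm K p (Measure.map (fun x : R3 => r • x) volume) :=
    (eLpNorm_map_measure hK.aestronglyMeasurable (by fun_prop)).symm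
  rw [h1, hm, eLpNorm_smul_measure_of_ne_zero, smul_eq_mul]
  · congr 1
    rw [finrank_euclideanSpace, Fintype.card_fin, abs_of_pos (by positivity), one_div,
      ENNReal.ofReal_inv_of_pos (by positivity), ENNReal.ofReal_pow hr.le, ENNReal.rpow_mul,
      ENNReal.rpow_neg]
    norm_num
  · exact (ENNReal.ofReal_pos.2 (abs_pos.2 (by positivity))).ne'

/-- Bernstein's inequality `‖m(D/r) T‖_∞ ≤ C r^{3/p} ‖T‖_p`. -/
theorem exists_lebesgueNorm_fieldMult_dilate_le {p : ℝ≥0∞} (hp : 1 ≤ p) (m : 𝓢(R3, ℂ)) :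
    ∃ C : ℝ≥0∞, C ≠ 0 ∧ C ≠ ⊤ ∧ ∀ (ι : Type) [Fintype ι] (r : ℝ) (hr : 0 < r) (T : DistField ι),
      lebesgueNorm ⊤ (fieldMult (dilate r hr.ne' m) T) ≤
        C * ENNReal.ofReal r ^ ((3 / p).toReal) * lebesgueNorm p T := by
  have := ENNReal.HolderConjugate.inv_one_sub_inv' hp
  have : ENNReal.HolderConjugate (1 - p⁻¹)⁻¹ p := ENNReal.HolderConjugate.symm
  set p' : ℝ≥0∞ := (1 - p⁻¹)⁻¹ with hp'
  set C : ℝ≥0∞ := eLpNorm (𝓕⁻ m : 𝓢(R3, ℂ)) p' volume + 1 with hC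
  have hCt : C ≠ ⊤ := ENNReal.add_ne_top.2 ⟨((𝓕⁻ m : 𝓢(R3, ℂ)).memLp p' volume).2.ne, by simp⟩
  have hC0 : C ≠ 0 := by simp [hC]
  refine ⟨C, hC0, hCt, fun ι _ r hr T => ?_⟩
  have hr0 : ENNReal.ofReal r ≠ 0 := by simpa using hr
  refine lebesgueNorm_fieldMult_le (p' := p') hp _
    (mul_ne_zero hC0 (by simp [hr0])) (ENNReal.mul_ne_top hCt (by simp [hr0])) ?_ T
  have h1 : ((𝓕⁻ (dilate r hr.ne' m) : 𝓢(R3, ℂ)) : R3 → ℂ) =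
      (r ^ 3 : ℝ) • fun x => (𝓕⁻ m : 𝓢(R3, ℂ)) (r • x) := by
    ext x; exact fourierInv_dilate_apply hr m x
  rw [h1, eLpNorm_const_smul, eLpNorm_comp_smul hr (SchwartzMap.continuous _), ← mul_assoc, mul_comm]
  gcongr
  · exact le_self_add
  -- The dilated kernel `r³ K(r ·)` has `L^{p'}` norm of order `r^{3 - 3/p'} = r^{3/p}`.
  · have h2 : (p'⁻¹).toReal = 1 - (p⁻¹).toReal := by
      rw [hp', inv_inv, ENNReal.toReal_sub_of_le (ENNReal.inv_le_one.2 hp) ENNReal.one_ne_top]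
      simp
    have h3 : (3 / p).toReal = 3 + -3 * (p'⁻¹).toReal := by
      rw [h2, div_eq_mul_inv, ENNReal.toReal_mul]
      simp; ring
    rw [h3, ENNReal.rpow_add _ _ hr0 ENNReal.ofReal_ne_top]
    gcongr
    rw [Real.enorm_eq_ofReal (by positivity), ENNReal.ofReal_pow hr.le]
    norm_cast

/-! ### Dyadic symbols and blocks. -/

variable {χ : R3 → ℝ}

theorem IsCutoff.contDiff_comp_smul (hχ : IsCutoff χ) (r : ℝ) :
    ContDiff ℝ ∞ fun ξ => χ (r • ξ) :=
  hχ.smooth.comp (contDiff_const_smul r)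

theorem IsCutoff.hasCompactSupport (hχ : IsCutoff χ) : HasCompactSupport χ :=
  HasCompactSupport.intro (isCompact_closedBall (0 : R3) 1) fun ξ hξ =>
    hχ.eq_zero ξ (by simpa using (not_le.1 (by simpa using hξ)).le)

/-- The cut-off as a Schwartz function. -/
noncomputable def lowSymbol (hχ : IsCutoff χ) : 𝓢(R3, ℂ) :=
  HasCompactSupport.toSchwartzMap (f := Complex.ofRealCLM ∘ χ) (hχ.hasCompactSupport.comp_left rfl)
    (Complex.ofRealCLM.contDiff.comp hχ.smooth)

theorem lowSymbol_apply (hχ : IsCutoff χ) (ξ : R3) : lowSymbol hχ ξ = (χ ξ : ℂ) := rfl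

/-- The generating symbols of the dyadic blocks: the `j`-th symbol is the dilation of
`baseSymbol hχ j` by `2 ^ j`. -/
noncomputable def baseSymbol (hχ : IsCutoff χ) (j : ℤ) : 𝓢(R3, ℂ) :=
  if 0 ≤ j then dilate 2 two_ne_zero (lowSymbol hχ) - lowSymbol hχ
  -- Chosen so that dilating by `2^{-1}` returns `χ`, the symbol of index `-1`.
  else dilate 2 two_ne_zero (lowSymbol hχ)

theorem zpow_two_pos (j : ℤ) : (0 : ℝ) < 2 ^ j := zpow_pos two_pos j

/-- The symbol of the dyadic block as a Schwartz function. -/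
noncomputable def blockSymbol (hχ : IsCutoff χ) (j : ℤ) : 𝓢(R3, ℂ) :=
  dilate (2 ^ j) (zpow_two_pos j).ne' (baseSymbol hχ j)

theorem blockSymbol_apply (hχ : IsCutoff χ) {j : ℤ} (hj : -1 ≤ j) (ξ : R3) :
    blockSymbol hχ j ξ = (symbol χ j ξ : ℂ) := by
  rw [blockSymbol, dilate_apply, symbol, baseSymbol]
  split_ifs with h h1
  · simp [lowSymbol_apply]
  · subst h1
    simp [lowSymbol_apply, smul_smul]
  · omega

theorem block_eq_fieldMult {ι : Type} (hχ : IsCutoff χ) {j : ℤ} (hj : -1 ≤ j) (T : DistField ι) :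
    block χ j T = fieldMult (blockSymbol hχ j) T := by
  have : (blockSymbol hχ j : R3 → ℂ) = fun ξ => (symbol χ j ξ : ℂ) :=
    funext (blockSymbol_apply hχ hj)
  rw [this]
  rfl

theorem lam_eq_ofReal (j : ℤ) : lam j = ENNReal.ofReal (2 ^ j) := by
  have h : (2 : ℝ) ^ j = ((2 : NNReal) ^ j : NNReal) := by push_cast; rfl
  rw [lam, h, ENNReal.ofReal_coe_nnreal, ENNReal.coe_zpow two_ne_zero]
  rfl

theorem lam_ne_zero (j : ℤ) : lam j ≠ 0 := by
  rw [lam_eq_ofReal]; exact (ENNReal.ofReal_pos.2 (zpow_two_pos j)).ne'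

theorem lam_ne_top (j : ℤ) : lam j ≠ ⊤ := by
  rw [lam_eq_ofReal]; exact ENNReal.ofReal_ne_top

theorem lam_mono : Monotone lam := fun i j h => by
  rw [lam_eq_ofReal, lam_eq_ofReal]
  exact ENNReal.ofReal_le_ofReal (zpow_le_zpow_right₀ one_le_two h)

theorem lam_add_one (j : ℤ) : lam (j + 1) = lam j * 2 := by
  rw [lam, lam, ENNReal.zpow_add two_ne_zero (by simp), zpow_one]

/-- Bernstein's inequality for dyadic blocks. -/
theorem exists_lebesgueNorm_block_le (hχ : IsCutoff χ) {p : ℝ≥0∞} (hp : 1 ≤ p) :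
    ∃ C : ℝ≥0∞, C ≠ 0 ∧ C ≠ ⊤ ∧ ∀ (ι : Type) [Fintype ι] (j : ℤ) (_ : -1 ≤ j) (T : DistField ι),
      lebesgueNorm ⊤ (block χ j T) ≤ C * lam j ^ (3 / p).toReal * lebesgueNorm p T := by
  obtain ⟨C, hC0, hCt, hC⟩ := exists_lebesgueNorm_fieldMult_dilate_le hp (baseSymbol hχ 0)
  obtain ⟨D, hD0, hDt, hD⟩ := exists_lebesgueNorm_fieldMult_dilate_le hp (baseSymbol hχ (-1))
  refine ⟨C + D, by simp [hC0], ENNReal.add_ne_top.2 ⟨hCt, hDt⟩, fun ι _ j hj T => ?_⟩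
  rw [block_eq_fieldMult hχ hj, blockSymbol, lam_eq_ofReal]
  rcases le_or_gt 0 j with h | h
  · have : baseSymbol hχ j = baseSymbol hχ 0 := by simp [baseSymbol, h]
    rw [this]
    refine (hC ι _ (zpow_two_pos j) T).trans ?_
    gcongr
    exact le_self_add
  · obtain rfl : j = -1 := by omega
    refine (hD ι _ (zpow_two_pos (-1)) T).trans ?_
    gcongr
    exact le_add_self

theorem fieldMult_fieldMult {ι : Type} {m₁ m₂ : R3 → ℂ} (h₁ : m₁.HasTemperateGrowth)
    (h₂ : m₂.HasTemperateGrowth) (T : DistField ι) :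
    fieldMult m₂ (fieldMult m₁ T) = fieldMult (m₁ * m₂) T :=
  funext fun i => TemperedDistribution.fourierMultiplierCLM_fourierMultiplierCLM_apply h₁ h₂ (T i)

theorem fieldMult_zero {ι : Type} (T : DistField ι) : fieldMult 0 T = 0 := by
  funext i
  change TemperedDistribution.fourierMultiplierCLM ℂ (fun _ => (0 : ℂ)) (T i) = 0
  rw [TemperedDistribution.fourierMultiplierCLM_const, zero_smul]
  rfl

theorem symbol_eq_zero_of_le (hχ : IsCutoff χ) {j : ℤ} {ξ : R3} (h : 2 ^ (j + 1) ≤ ‖ξ‖) :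
    symbol χ j ξ = 0 := by
  have hp := zpow_two_pos j
  rw [zpow_add_one₀ two_ne_zero] at h
  unfold symbol
  split_ifs with h0 h1
  · rw [hχ.eq_zero, hχ.eq_zero, sub_zero]
    · rw [norm_smul, norm_inv, Real.norm_of_nonneg hp.le, inv_mul_eq_div, le_div_iff₀ hp]
      linarith
    · rw [norm_smul, norm_smul, norm_inv, norm_inv, Real.norm_of_nonneg hp.le, inv_mul_eq_div,
        inv_mul_eq_div, Real.norm_of_nonneg two_pos.le, le_div_iff₀ two_pos, le_div_iff₀ hp]
      linarith
  · subst h1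
    refine hχ.eq_zero _ ?_
    norm_num at h
    exact h
  · rfl

theorem symbol_eq_zero_of_ge (hχ : IsCutoff χ) {j : ℤ} (hj : 0 ≤ j) {ξ : R3}
    (h : ‖ξ‖ ≤ 3 / 4 * 2 ^ j) : symbol χ j ξ = 0 := by
  have hp := zpow_two_pos j
  have h1 : ‖((2 : ℝ) ^ j)⁻¹ • ξ‖ ≤ 3 / 4 := by
    rw [norm_smul, norm_inv, Real.norm_of_nonneg hp.le, inv_mul_eq_div, div_le_iff₀ hp]
    exact h
  rw [symbol, if_pos hj, hχ.eq_one _ h1, hχ.eq_one, sub_self]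
  rw [norm_smul, norm_inv, Real.norm_of_nonneg two_pos.le]
  linarith [norm_nonneg (((2 : ℝ) ^ j)⁻¹ • ξ)]

/-- Disjoint supports: the first factor needs `|ξ| < 2^{j+1}`, the second `|ξ| > ¾ · 2^k ≥ 3 · 2^j`.
-/
theorem symbol_mul_symbol (hχ : IsCutoff χ) {j k : ℤ} (hj : -1 ≤ j) (hjk : j + 2 ≤ k) (ξ : R3) :
    symbol χ j ξ * symbol χ k ξ = 0 := by
  rcases le_or_gt (2 ^ (j + 1)) ‖ξ‖ with h | h
  · rw [symbol_eq_zero_of_le hχ h, zero_mul]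
  · rw [symbol_eq_zero_of_ge hχ (j := k) (by omega), mul_zero]
    have h2 : (2 : ℝ) ^ (j + 2) ≤ 2 ^ k := zpow_le_zpow_right₀ one_le_two hjk
    have h3 : (2 : ℝ) ^ (j + 2) = 2 ^ (j + 1) * 2 := by
      rw [← zpow_add_one₀ two_ne_zero]; congr 1; ring
    have := zpow_two_pos (j + 1)
    linarith

theorem block_block_eq_zero {ι : Type} (hχ : IsCutoff χ) {j k : ℤ} (hj : -1 ≤ j) (hk : -1 ≤ k)
    (hjk : j + 2 ≤ k ∨ k + 2 ≤ j) (T : DistField ι) : block χ j (block χ k T) = 0 := by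
  rw [block_eq_fieldMult hχ hj, block_eq_fieldMult hχ hk,
    fieldMult_fieldMult (SchwartzMap.hasTemperateGrowth _) (SchwartzMap.hasTemperateGrowth _)]
  convert! fieldMult_zero T
  ext ξ
  rw [Pi.mul_apply, blockSymbol_apply hχ hj, blockSymbol_apply hχ hk, ← Complex.ofReal_mul]
  rcases hjk with h | h
  · rw [mul_comm, symbol_mul_symbol hχ hj h]; rfl
  · rw [symbol_mul_symbol hχ hk h]; rfl

theorem hasTemperateGrowth_inner (a : R3) :
    (fun ξ : R3 => ((inner ℝ ξ a : ℝ) : ℂ)).HasTemperateGrowth := by fun_prop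

/-- Derivatives are themselves multipliers, so they commute with `m(D)`. This turns `∇(b_{≤Q})` into
`(∇b)_{≤Q}`. -/
theorem gradDist_fieldMult {m : R3 → ℂ} (hm : m.HasTemperateGrowth) (T : DistField (Fin 3)) :
    gradDist (fieldMult m T) = fieldMult m (gradDist T) := by
  funext ij
  simp only [gradDist, fieldMult, TemperedDistribution.lineDeriv_eq_fourierMultiplierCLM, map_smul]
  rw [TemperedDistribution.fourierMultiplierCLM_fourierMultiplierCLM_apply hm
      (hasTemperateGrowth_inner _),
    TemperedDistribution.fourierMultiplierCLM_fourierMultiplierCLM_apply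
      (hasTemperateGrowth_inner _) hm, mul_comm m]

theorem gradDist_block (hχ : IsCutoff χ) {j : ℤ} (hj : -1 ≤ j) (T : DistField (Fin 3)) :
    gradDist (block χ j T) = block χ j (gradDist T) := by
  rw [block_eq_fieldMult hχ hj, block_eq_fieldMult hχ hj]
  exact gradDist_fieldMult (SchwartzMap.hasTemperateGrowth _) T

theorem gradDist_lowFreq (hχ : IsCutoff χ) (Q : ℕ∞) (T : DistField (Fin 3)) :
    gradDist (lowFreq χ Q T) = lowFreq χ Q (gradDist T) := by
  cases Q with
  | top => rfl
  | coe n =>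
    funext ij
    simp only [gradDist, lowFreq]
    change LineDeriv.lineDerivOpCLM ℂ 𝓢'(R3, ℂ) (e ij.1) _ = _
    rw [map_sum]
    refine Finset.sum_congr rfl fun q hq => ?_
    exact congrFun (gradDist_block hχ (Finset.mem_Icc.1 hq).1 T) ij

/-! ### The inverse Bernstein inequality. -/

theorem Represents.smul {T : DistField ι} {g : R3 → EuclideanSpace ℂ ι} (hg : Represents g T)
    (c : ℂ) : Represents (c • g) (c • T) := by
  refine ⟨hg.1.smul c, fun i ψ => ?_⟩
  obtain ⟨h1, h2⟩ := hg.2 i ψ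
  have : (fun x => ψ x * (c • g) x i) = fun x => c * (ψ x * g x i) := by
    ext x; simp; ring
  rw [this]
  refine ⟨h1.const_mul c, ?_⟩
  rw [integral_const_mul, ← h2]
  rfl

theorem lebesgueNorm_smul_le (r : ℝ≥0∞) {c : ℂ} (hc : c ≠ 0) (T : DistField ι) :
    lebesgueNorm r (c • T) ≤ ‖c‖ₑ * lebesgueNorm r T := by
  rw [lebesgueNorm.eq_def r T]
  simp_rw [ENNReal.mul_iInf_of_ne (enorm_ne_zero.2 hc) enorm_ne_top]
  refine le_iInf fun g => le_iInf fun hg => ?_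
  exact (hg.smul c).lebesgueNorm_le.trans (eLpNorm_const_smul c g r volume).le

/-- The symbol `θ(ξ) ξᵢ / |ξ|²`, where `θ` is a cut-off to an annulus. -/
noncomputable def inverseGradFun (χ : R3 → ℝ) (i : Fin 3) (ξ : R3) : ℝ :=
  (χ ((4 : ℝ)⁻¹ • ξ) - χ ((2 : ℝ) • ξ)) * (ξ i / ‖ξ‖ ^ 2)

/-- The annular factor vanishes for `|ξ| < 3/8`, so the division by `|ξ|²` creates no singularity.
-/
theorem contDiff_inverseGradFun (hχ : IsCutoff χ) (i : Fin 3) :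
    ContDiff ℝ ∞ (inverseGradFun χ i) := by
  rw [contDiff_iff_contDiffAt]
  intro ξ
  by_cases h : ξ = 0
  · subst h
    refine (contDiffAt_const (c := (0 : ℝ))).congr_of_eventuallyEq ?_
    filter_upwards [Metric.ball_mem_nhds (0 : R3) (show (0 : ℝ) < 3 / 8 by norm_num)] with η hη
    have hη' : ‖η‖ < 3 / 8 := by simpa using hη
    rw [inverseGradFun, hχ.eq_one, hχ.eq_one, sub_self, zero_mul]
    · rw [norm_smul, Real.norm_of_nonneg two_pos.le]; linarith
    · rw [norm_smul, norm_inv, Real.norm_of_nonneg (by norm_num : (0 : ℝ) ≤ 4)]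
      linarith [norm_nonneg η]
  · refine ContDiffAt.mul ((hχ.contDiff_comp_smul _).sub (hχ.contDiff_comp_smul _)).contDiffAt
      (ContDiffAt.div ?_ (contDiff_norm_sq ℝ).contDiffAt (by simpa using h))
    exact (EuclideanSpace.proj i : R3 →L[ℝ] ℝ).contDiff.contDiffAt

theorem hasCompactSupport_inverseGradFun (hχ : IsCutoff χ) (i : Fin 3) :
    HasCompactSupport (inverseGradFun χ i) := by
  refine HasCompactSupport.intro (isCompact_closedBall (0 : R3) 4) fun ξ hξ => ?_
  have h : 4 < ‖ξ‖ := by simpa using hξ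
  rw [inverseGradFun, hχ.eq_zero, hχ.eq_zero, sub_self, zero_mul]
  · rw [norm_smul, Real.norm_of_nonneg two_pos.le]; linarith
  · rw [norm_smul, norm_inv, Real.norm_of_nonneg (by norm_num : (0 : ℝ) ≤ 4)]
    linarith

/-- `inverseGradFun` as a complex Schwartz function. -/
noncomputable def inverseGradSymbol (hχ : IsCutoff χ) (i : Fin 3) : 𝓢(R3, ℂ) :=
  HasCompactSupport.toSchwartzMap (f := Complex.ofRealCLM ∘ inverseGradFun χ i)
    ((hasCompactSupport_inverseGradFun hχ i).comp_left rfl)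
    (Complex.ofRealCLM.contDiff.comp (contDiff_inverseGradFun hχ i))

theorem inverseGradSymbol_apply (hχ : IsCutoff χ) (i : Fin 3) (ξ : R3) :
    inverseGradSymbol hχ i ξ = (inverseGradFun χ i ξ : ℂ) := rfl

/-- `∑ ηᵢ · ηᵢ/|η|² = 1`, and the annular factor is `1` for `½ ≤ |η| ≤ 3`, which contains the
support of the symbol of index `0`. -/
theorem sum_inverseGradFun_mul (hχ : IsCutoff χ) (η : R3) :
    (∑ i, inverseGradFun χ i η * η i) * symbol χ 0 η = symbol χ 0 η := by
  by_cases h : symbol χ 0 η = 0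
  · rw [h, mul_zero]
  have h1 : ‖η‖ < 2 := by
    by_contra h1
    exact h (symbol_eq_zero_of_le hχ (by simpa using h1))
  have h2 : 3 / 4 < ‖η‖ := by
    by_contra h2
    exact h (symbol_eq_zero_of_ge hχ le_rfl (by simpa using h2))
  have h3 : ∀ i, inverseGradFun χ i η * η i = η i ^ 2 / ‖η‖ ^ 2 := by
    intro i
    rw [inverseGradFun, hχ.eq_one, hχ.eq_zero]
    · ring
    · rw [norm_smul, Real.norm_of_nonneg two_pos.le]; linarith
    · rw [norm_smul, norm_inv, Real.norm_of_nonneg (by norm_num : (0 : ℝ) ≤ 4)]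
      linarith
  have h4 : ‖η‖ ^ 2 = ∑ i, η i ^ 2 := by
    rw [EuclideanSpace.norm_sq_eq]; simp
  simp_rw [h3]
  rw [← Finset.sum_div, ← h4, div_self (by positivity), one_mul]

theorem symbol_eq_symbol_zero {j : ℤ} (hj : 0 ≤ j) (ξ : R3) :
    symbol χ j ξ = symbol χ 0 (((2 : ℝ) ^ j)⁻¹ • ξ) := by
  simp [symbol, hj]

/-- Recovers a block from its gradient. On the Fourier side `∂ᵢ` is `2πi ξᵢ`, and `ξᵢ = 2^j ηᵢ` in
the rescaled variable `η = 2^{-j} ξ`; inverting these factors gives the prefactor. -/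
theorem block_eq_sum_gradDist (hχ : IsCutoff χ) {j : ℤ} (hj : 0 ≤ j) (T : DistField (Fin 3)) :
    block χ j T = ((2 * Real.pi * Complex.I)⁻¹ * ((2 : ℂ) ^ j)⁻¹) • ∑ i,
      fieldMult (dilate (2 ^ j) (zpow_two_pos j).ne' (inverseGradSymbol hχ i))
        (fun a => block χ j (gradDist T) (i, a)) := by
  have hj' : -1 ≤ j := by omega
  set D : Fin 3 → 𝓢(R3, ℂ) := fun i =>
    dilate (2 ^ j) (zpow_two_pos j).ne' (inverseGradSymbol hχ i) with hD
  have hDt : ∀ i, (D i : R3 → ℂ).HasTemperateGrowth := fun i => (D i).hasTemperateGrowth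
  have hbt : (blockSymbol hχ j : R3 → ℂ).HasTemperateGrowth :=
    (blockSymbol hχ j).hasTemperateGrowth
  have h2j : (2 : ℂ) ^ j ≠ 0 := zpow_ne_zero _ two_ne_zero
  have hpi : (2 * Real.pi * Complex.I : ℂ) ≠ 0 := by
    simp [Real.pi_ne_zero]
  have hsym : ((2 : ℂ) ^ j) • (blockSymbol hχ j : R3 → ℂ) = fun ξ => ∑ i,
      ((fun ξ : R3 => ((inner ℝ ξ (e i) : ℝ) : ℂ)) * (blockSymbol hχ j : R3 → ℂ) * D i) ξ := by
    ext ξ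
    have h := sum_inverseGradFun_mul hχ (((2 : ℝ) ^ j)⁻¹ • ξ)
    rw [← symbol_eq_symbol_zero hj] at h
    have h' : symbol χ j ξ * 2 ^ j = ∑ i, ξ i * symbol χ j ξ *
        inverseGradFun χ i (((2 : ℝ) ^ j)⁻¹ • ξ) := by
      have := zpow_two_pos j
      conv_lhs => rw [← h, mul_right_comm, Finset.sum_mul, Finset.sum_mul]
      refine Finset.sum_congr rfl fun i _ => ?_
      simp only [PiLp.smul_apply, smul_eq_mul]
      field_simp
    have hin : ∀ i, inner ℝ ξ (e i) = ξ i := by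
      intro i; simp [e, EuclideanSpace.inner_single_right]
    simp only [Pi.smul_apply, Pi.mul_apply, smul_eq_mul, hin, blockSymbol_apply hχ hj', hD,
      dilate_apply, inverseGradSymbol_apply]
    rw [mul_comm]
    have h'' := congrArg (fun r : ℝ => (r : ℂ)) h'
    push_cast at h''
    exact h''
  funext a
  rw [block_eq_fieldMult hχ hj', block_eq_fieldMult hχ hj']
  rw [Pi.smul_apply, Finset.sum_apply, mul_smul, eq_inv_smul_iff₀ hpi, eq_inv_smul_iff₀ h2j]
  rw [smul_comm]
  have hterm : ∀ i, fieldMult (D i) (fun a => fieldMult (blockSymbol hχ j) (gradDist T) (i, a)) a =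
      (2 * Real.pi * Complex.I) • TemperedDistribution.fourierMultiplierCLM ℂ
        ((fun ξ : R3 => ((inner ℝ ξ (e i) : ℝ) : ℂ)) * (blockSymbol hχ j : R3 → ℂ) * (D i : R3 → ℂ))
          (T a) := by
    intro i
    simp only [gradDist, fieldMult, TemperedDistribution.lineDeriv_eq_fourierMultiplierCLM]
    rw [map_smul, map_smul,
      TemperedDistribution.fourierMultiplierCLM_fourierMultiplierCLM_apply
        (hasTemperateGrowth_inner _) hbt,
      TemperedDistribution.fourierMultiplierCLM_fourierMultiplierCLM_apply
        ((hasTemperateGrowth_inner _).mul hbt) (hDt i)]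
  rw [Finset.sum_congr rfl (g := fun i => _) fun i _ => hterm i, ← Finset.smul_sum]
  congr 1
  have h := congrArg (fun L => L (T a)) (TemperedDistribution.fourierMultiplierCLM_sum ℂ
    (s := Finset.univ) (fun i _ => ((hasTemperateGrowth_inner (e i)).mul hbt).mul (hDt i)))
  have h' := congrArg (fun L => L (T a)) (TemperedDistribution.fourierMultiplierCLM_smul
    (F := ℂ) hbt ((2 : ℂ) ^ j))
  rw [hsym] at h'
  simp only [sum_apply, smul_apply] at h h'
  exact h'.symm.trans h

/-- Bernstein's inequality `λ_j ‖Δ_j T‖_∞ ≤ C ‖Δ_j ∇T‖_∞` for `j ≥ 0`. -/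
theorem exists_lebesgueNorm_block_le_gradDist (hχ : IsCutoff χ) :
    ∃ C : ℝ≥0∞, C ≠ ⊤ ∧ ∀ (j : ℤ) (_ : 0 ≤ j) (T : DistField (Fin 3)),
      lebesgueNorm ⊤ (block χ j T) ≤ C * (lam j)⁻¹ * lebesgueNorm ⊤ (block χ j (gradDist T)) := by
  have h := fun i => exists_lebesgueNorm_fieldMult_dilate_le (p := ⊤) le_top
    (inverseGradSymbol hχ i)
  choose C hC0 hCt hC using h
  refine ⟨‖(2 * Real.pi * Complex.I : ℂ)⁻¹‖ₑ * ∑ i, C i,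
    ENNReal.mul_ne_top enorm_ne_top (ENNReal.sum_ne_top.2 fun i _ => hCt i), fun j hj T => ?_⟩
  have h2j : (2 : ℂ) ^ j ≠ 0 := zpow_ne_zero _ two_ne_zero
  have hpi : (2 * Real.pi * Complex.I : ℂ) ≠ 0 := by
    simp [Real.pi_ne_zero]
  rw [block_eq_sum_gradDist hχ hj T]
  refine (lebesgueNorm_smul_le _ (mul_ne_zero (inv_ne_zero hpi) (inv_ne_zero h2j)) _).trans ?_
  have hnorm : ‖((2 : ℂ) ^ j)⁻¹‖ₑ = (lam j)⁻¹ := by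
    rw [enorm_inv h2j, ← ofReal_norm, norm_zpow, lam_eq_ofReal]
    simp
  rw [enorm_mul, hnorm]
  calc _ ≤ ‖(2 * Real.pi * Complex.I : ℂ)⁻¹‖ₑ * (lam j)⁻¹ *
        ∑ i, C i * lebesgueNorm ⊤ (block χ j (gradDist T)) := by
        gcongr
        refine (lebesgueNorm_sum_le le_top _ _).trans (Finset.sum_le_sum fun i _ => ?_)
        refine (hC i _ _ (zpow_two_pos j) _).trans ?_
        simp only [ENNReal.div_top, ENNReal.toReal_zero, ENNReal.rpow_zero, mul_one]
        gcongr
        exact lebesgueNorm_comp_le ⊤ (Prod.mk_right_injective i) (block χ j (gradDist T))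
    _ = _ := by rw [← Finset.sum_mul]; ring

/-! ### Besov norm of a truncated field. -/

/-- The low frequencies in `B^1_{∞,∞}`. -/
theorem exists_besovNorm_lowFreq_le (hχ : IsCutoff χ) :
    ∃ C : ℝ≥0∞, C ≠ ⊤ ∧ ∀ (ι : Type) [Fintype ι] (n : ℕ) (T : DistField ι) (S : ℝ≥0∞),
      (∀ j : ℤ, -1 ≤ j → j ≤ n → lam j * lebesgueNorm ⊤ (block χ j T) ≤ S) →
      besovNorm χ 1 ⊤ (lowFreq χ n T) ≤ C * S := by
  obtain ⟨C, -, hCt, hC⟩ := exists_lebesgueNorm_block_le hχ (p := ⊤) le_top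
  -- `3` counts the blocks `|j - k| ≤ 1` that meet block `k`, `2` comes from `λ_k ≤ 2 λ_j`, and `C`
  -- bounds `Δ_k` on `L^∞`.
  refine ⟨3 * (2 * C), by finiteness, fun ι _ n T S hS => iSup₂_le fun k hk => ?_⟩
  simp only [ENNReal.div_top, ENNReal.toReal_zero, ENNReal.rpow_zero, mul_one] at hC
  rw [ENNReal.rpow_one]
  have h1 : block χ k (lowFreq χ n T) =
      ∑ j ∈ Finset.Icc (-1 : ℤ) n, block χ k (block χ j T) := by
    have h2 : lowFreq χ n T = ∑ j ∈ Finset.Icc (-1 : ℤ) n, block χ j T := by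
      funext i
      rw [Finset.sum_apply]
      rfl
    rw [h2, block_eq_fieldMult hχ hk, fieldMult_sum]
    refine Finset.sum_congr rfl fun j _ => ?_
    rw [← block_eq_fieldMult hχ hk]
  have h3 : block χ k (lowFreq χ n T) =
      ∑ j ∈ (Finset.Icc (-1 : ℤ) n) with j ∈ Finset.Icc (k - 1) (k + 1),
        block χ k (block χ j T) := by
    rw [h1, Finset.sum_filter_of_ne]
    intro j hj hne
    by_contra hcon
    refine hne (block_block_eq_zero hχ hk (Finset.mem_Icc.1 hj).1 ?_ T)
    rw [Finset.mem_Icc] at hcon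
    omega
  rw [h3]
  calc lam k * lebesgueNorm ⊤ (∑ j ∈ (Finset.Icc (-1 : ℤ) n) with j ∈ Finset.Icc (k - 1) (k + 1),
        block χ k (block χ j T))
      ≤ lam k * ∑ j ∈ (Finset.Icc (-1 : ℤ) n) with j ∈ Finset.Icc (k - 1) (k + 1),
        C * lebesgueNorm ⊤ (block χ j T) := by
        gcongr
        exact (lebesgueNorm_sum_le le_top _ _).trans
          (Finset.sum_le_sum fun j _ => hC _ k hk _)
    _ = ∑ j ∈ (Finset.Icc (-1 : ℤ) n) with j ∈ Finset.Icc (k - 1) (k + 1),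
        lam k * (C * lebesgueNorm ⊤ (block χ j T)) := Finset.mul_sum _ _ _
    _ ≤ ∑ j ∈ (Finset.Icc (-1 : ℤ) n) with j ∈ Finset.Icc (k - 1) (k + 1), 2 * C * S := by
        refine Finset.sum_le_sum fun j hj => ?_
        rw [Finset.mem_filter, Finset.mem_Icc, Finset.mem_Icc] at hj
        have h4 : lam k ≤ lam j * 2 := by
          rw [← lam_add_one]; exact lam_mono (by omega)
        calc lam k * (C * lebesgueNorm ⊤ (block χ j T))
            ≤ lam j * 2 * (C * lebesgueNorm ⊤ (block χ j T)) := by gcongr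
          _ = 2 * C * (lam j * lebesgueNorm ⊤ (block χ j T)) := by ring
          _ ≤ 2 * C * S := by gcongr; exact hS j hj.1.1 hj.1.2
    _ ≤ ∑ j ∈ Finset.Icc (k - 1) (k + 1), 2 * C * S :=
        Finset.sum_le_sum_of_subset fun j hj => (Finset.mem_filter.1 hj).2
    _ = 3 * (2 * C) * S := by
        rw [Finset.sum_const, Int.card_Icc, show k + 1 + 1 - (k - 1) = 3 by ring, nsmul_eq_mul]
        rw [mul_assoc 3]
        rfl

/-! ### Blocks of BMO fields. -/

/-- The mean oscillation of `g` over every ball is at most `O`. -/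
def MeanOscillationLE (g : R3 → EuclideanSpace ℂ ι) (O : ℝ≥0∞) : Prop :=
  ∀ (x : R3) (r : ℝ), 0 < r →
    ⨍⁻ y in Metric.ball x r, ‖g y - (⨍ z in Metric.ball x r, g z ∂volume)‖ₑ ∂volume ≤ O

theorem volume_ball_eq (x : R3) {r : ℝ} (hr : 0 ≤ r) :
    volume (Metric.ball x r) = ENNReal.ofReal (r ^ 3) * volume (Metric.ball (0 : R3) 1) := by
  simpa [finrank_euclideanSpace] using Measure.addHaar_ball_mul (volume : Measure R3) x hr 1

theorem MeanOscillationLE.lintegral_le {g : R3 → EuclideanSpace ℂ ι} {O : ℝ≥0∞}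
    (h : MeanOscillationLE g O) (x : R3) {r : ℝ} (hr : 0 < r) :
    ∫⁻ y in Metric.ball x r, ‖g y - (⨍ z in Metric.ball x r, g z ∂volume)‖ₑ ≤
      volume (Metric.ball x r) * O := by
  have := h x r hr
  rw [setLAverage_eq, ENNReal.div_le_iff (Metric.measure_ball_pos _ _ hr).ne'
    measure_ball_lt_top.ne] at this
  rwa [mul_comm]

/-- Compare both averages with `g` on the small ball: its own oscillation costs `O`, that of the
double ball `2³ O`, hence `9 = 1 + 8`. -/
theorem MeanOscillationLE.enorm_average_sub_le {g : R3 → EuclideanSpace ℂ ι} {O : ℝ≥0∞}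
    (h : MeanOscillationLE g O) (hg : AEStronglyMeasurable g volume) (x : R3) {r : ℝ}
    (hr : 0 < r) :
    ‖(⨍ z in Metric.ball x (2 * r), g z ∂volume) - (⨍ z in Metric.ball x r, g z ∂volume)‖ₑ ≤
      9 * O := by
  set c := ⨍ z in Metric.ball x r, g z ∂volume
  set d := ⨍ z in Metric.ball x (2 * r), g z ∂volume
  have hv : volume (Metric.ball x (2 * r)) = 8 * volume (Metric.ball x r) := by
    rw [volume_ball_eq x (by positivity), volume_ball_eq x hr.le, mul_pow,
      ENNReal.ofReal_mul (by positivity), mul_assoc]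
    norm_num
  have h1 := h.lintegral_le x hr
  have h2 : ∫⁻ y in Metric.ball x r, ‖g y - d‖ₑ ≤ 8 * volume (Metric.ball x r) * O := by
    rw [← hv]
    exact (lintegral_mono_set (Metric.ball_subset_ball (by linarith))).trans
      (h.lintegral_le x (by positivity : 0 < 2 * r))
  have hpos := (Metric.measure_ball_pos (volume : Measure R3) x hr).ne'
  have hfin := (measure_ball_lt_top (μ := (volume : Measure R3)) (x := x) (r := r)).ne
  have h3 : volume (Metric.ball x r) * ‖d - c‖ₑ ≤ volume (Metric.ball x r) * (9 * O) := by
    calc volume (Metric.ball x r) * ‖d - c‖ₑ = ∫⁻ y in Metric.ball x r, ‖d - c‖ₑ := by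
          rw [setLIntegral_const, mul_comm]
      _ ≤ ∫⁻ y in Metric.ball x r, (‖g y - c‖ₑ + ‖g y - d‖ₑ) := by
          refine lintegral_mono fun y => ?_
          have : d - c = (g y - c) - (g y - d) := by abel
          rw [this]
          exact enorm_sub_le
      _ = (∫⁻ y in Metric.ball x r, ‖g y - c‖ₑ) + ∫⁻ y in Metric.ball x r, ‖g y - d‖ₑ :=
          lintegral_add_left' (hg.sub aestronglyMeasurable_const).enorm.restrict _
      _ ≤ volume (Metric.ball x r) * O + 8 * volume (Metric.ball x r) * O := add_le_add h1 h2
      _ = volume (Metric.ball x r) * (9 * O) := by ring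
  exact (ENNReal.mul_le_mul_iff_right hpos hfin).1 h3

/-- Telescoping over `k` doublings moves the average by at most `9kO`; the oscillation on the large
ball adds `O`. -/
theorem MeanOscillationLE.lintegral_ball_le {g : R3 → EuclideanSpace ℂ ι} {O : ℝ≥0∞}
    (h : MeanOscillationLE g O) (hg : AEStronglyMeasurable g volume) (x : R3) {r : ℝ}
    (hr : 0 < r) (k : ℕ) :
    ∫⁻ y in Metric.ball x (2 ^ k * r), ‖g y - (⨍ z in Metric.ball x r, g z ∂volume)‖ₑ ≤
      volume (Metric.ball x (2 ^ k * r)) * ((1 + 9 * k) * O) := by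
  set c := ⨍ z in Metric.ball x r, g z ∂volume with hc
  have hsum : ∀ k : ℕ,
      ‖(⨍ z in Metric.ball x (2 ^ k * r), g z ∂volume) - c‖ₑ ≤ 9 * k * O := by
    intro k
    induction k with
    | zero => simp [hc]
    | succ k ih =>
      have hstep := h.enorm_average_sub_le hg x (by positivity : 0 < 2 ^ k * r)
      rw [← mul_assoc, ← pow_succ'] at hstep
      set d := ⨍ z in Metric.ball x (2 ^ k * r), g z ∂volume
      set d' := ⨍ z in Metric.ball x (2 ^ (k + 1) * r), g z ∂volume
      calc ‖d' - c‖ₑ = ‖(d' - d) + (d - c)‖ₑ := by rw [sub_add_sub_cancel]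
        _ ≤ 9 * O + 9 * k * O := (enorm_add_le _ _).trans (add_le_add hstep ih)
        _ = 9 * ((k + 1 : ℕ) : ℝ≥0∞) * O := by push_cast; ring
  set d := ⨍ z in Metric.ball x (2 ^ k * r), g z ∂volume with hd
  calc ∫⁻ y in Metric.ball x (2 ^ k * r), ‖g y - c‖ₑ
      ≤ ∫⁻ y in Metric.ball x (2 ^ k * r), (‖g y - d‖ₑ + ‖d - c‖ₑ) := by
        refine lintegral_mono fun y => ?_
        rw [← sub_add_sub_cancel (g y) d c]
        exact enorm_add_le _ _
    _ = (∫⁻ y in Metric.ball x (2 ^ k * r), ‖g y - d‖ₑ) +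
          volume (Metric.ball x (2 ^ k * r)) * ‖d - c‖ₑ := by
        rw [lintegral_add_right _ measurable_const, setLIntegral_const, mul_comm ‖d - c‖ₑ]
    _ ≤ volume (Metric.ball x (2 ^ k * r)) * O +
          volume (Metric.ball x (2 ^ k * r)) * (9 * k * O) := by
        gcongr
        · exact h.lintegral_le x (by positivity)
        · exact hsum k
    _ = _ := by ring

theorem tsum_one_add_mul_half_pow_ne_top :
    ∑' k : ℕ, (1 + 9 * (k : ℝ≥0∞)) * ENNReal.ofReal ((1 / 2) ^ k) ≠ ⊤ := by
  have h : ∀ k : ℕ, (1 + 9 * (k : ℝ≥0∞)) * ENNReal.ofReal ((1 / 2) ^ k) =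
      ENNReal.ofReal ((1 + 9 * k) * (1 / 2) ^ k) := by
    intro k
    rw [ENNReal.ofReal_mul (by positivity), ENNReal.ofReal_add zero_le_one (by positivity),
      ENNReal.ofReal_mul (by norm_num)]
    simp
  simp_rw [h]
  have hs : Summable fun k : ℕ => (1 + 9 * (k : ℝ)) * (1 / 2) ^ k := by
    have h0 : Summable fun k : ℕ => ((1 : ℝ) / 2) ^ k :=
      summable_geometric_of_lt_one (by norm_num) (by norm_num)
    have h1 := summable_pow_mul_geometric_of_norm_lt_one 1 (r := (1 / 2 : ℝ)) (by norm_num)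
    refine (h0.add (h1.mul_left 9)).congr fun k => ?_
    ring
  rw [← ENNReal.ofReal_tsum_of_nonneg (fun k => by positivity) hs]
  exact ENNReal.ofReal_ne_top

/-- Dilates of a rapidly decaying kernel integrate the oscillation of a BMO function. -/
theorem exists_lintegral_kernel_mul_le (K : 𝓢(R3, ℂ)) :
    ∃ C : ℝ≥0∞, C ≠ ⊤ ∧ ∀ (ι : Type) [Fintype ι] (g : R3 → EuclideanSpace ℂ ι) (O : ℝ≥0∞)
      (_ : MeanOscillationLE g O) (_ : AEStronglyMeasurable g volume) (l : ℝ) (_ : 0 < l) (x : R3),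
      ∫⁻ y, ‖((l ^ 3 : ℝ) • K (l • (x - y))) •
        (g y - (⨍ z in Metric.ball x l⁻¹, g z ∂volume))‖ₑ ≤ C * O := by
  obtain ⟨A₀, hA₀, h₀⟩ := K.decay 0 0
  -- Decay of order four beats the volume growth: `16^{-k} · 8^k = 2^{-k}`, summable against `1 +
  -- 9k`.
  obtain ⟨A₄, hA₄, h₄⟩ := K.decay 4 0
  simp only [pow_zero, norm_iteratedFDeriv_zero, one_mul] at h₀ h₄
  set A := A₀ + A₄ with hA
  have hA0 : 0 < A := by positivity
  set V := volume (Metric.ball (0 : R3) 1)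
  have hV : V ≠ ⊤ := measure_ball_lt_top.ne
  refine ⟨ENNReal.ofReal (16 * A) * V *
    ∑' k : ℕ, (1 + 9 * (k : ℝ≥0∞)) * ENNReal.ofReal ((1 / 2) ^ k),
    ENNReal.mul_ne_top (ENNReal.mul_ne_top ENNReal.ofReal_ne_top hV)
      tsum_one_add_mul_half_pow_ne_top, fun ι _ g O h hg l hl x => ?_⟩
  set c := ⨍ z in Metric.ball x l⁻¹, g z ∂volume
  set B : ℕ → Set R3 := fun k => Metric.ball x (2 ^ k * l⁻¹) with hB
  have hl' : 0 < l⁻¹ := inv_pos.2 hl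
  have hBmono : Monotone B := fun i j hij => Metric.ball_subset_ball (by
    gcongr
    exact one_le_two)
  have hcover : (⋃ k, disjointed B k) = univ := by
    rw [iUnion_disjointed]
    refine eq_univ_of_forall fun y => mem_iUnion.2 ?_
    obtain ⟨k, hk⟩ := pow_unbounded_of_one_lt (dist y x * l) one_lt_two
    exact ⟨k, by rw [hB, Metric.mem_ball, ← div_eq_mul_inv, lt_div_iff₀ hl]; exact hk⟩
  -- Shell `k + 1` lies outside ball `k`, so the decay there is only `16^{-k}`; the factor `16` pays
  -- for this shift.
  have hker : ∀ k, ∀ y ∈ disjointed B k,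
      ‖(l ^ 3 : ℝ) • K (l • (x - y))‖ₑ ≤ ENNReal.ofReal (l ^ 3 * (16 * A * (1 / 16) ^ k)) := by
    intro k y hy
    rw [← ofReal_norm]
    refine ENNReal.ofReal_le_ofReal ?_
    rw [norm_smul, Real.norm_of_nonneg (by positivity)]
    gcongr
    cases k with
    | zero => linarith [h₀ (l • (x - y))]
    | succ k =>
      have hy' : y ∉ B k := by
        have hy2 := hBmono.disjointed_add_one k ▸ hy
        exact hy2.2
      have h5 : 2 ^ k ≤ ‖l • (x - y)‖ := by
        rw [norm_smul, Real.norm_of_nonneg hl.le, ← dist_eq_norm, dist_comm]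
        have : 2 ^ k * l⁻¹ ≤ dist y x := by simpa [hB] using hy'
        rwa [← div_eq_mul_inv, div_le_iff₀' hl] at this
      have h6 : (16 : ℝ) ^ k ≤ ‖l • (x - y)‖ ^ 4 := by
        calc (16 : ℝ) ^ k = (2 ^ k) ^ 4 := by rw [← pow_mul, mul_comm, pow_mul]; norm_num
          _ ≤ _ := by gcongr
      have h7 : (16 : ℝ) ^ k * ‖K (l • (x - y))‖ ≤ A := by
        calc (16 : ℝ) ^ k * ‖K (l • (x - y))‖ ≤ ‖l • (x - y)‖ ^ 4 * ‖K (l • (x - y))‖ := by gcongr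
          _ ≤ A := by linarith [h₄ (l • (x - y))]
      have h8 : 16 * A * (1 / 16 : ℝ) ^ (k + 1) = A / 16 ^ k := by
        rw [pow_succ, one_div_pow]; field_simp
      rw [h8, le_div_iff₀ (by positivity), mul_comm]
      exact h7
  calc ∫⁻ y, ‖((l ^ 3 : ℝ) • K (l • (x - y))) • (g y - c)‖ₑ
      = ∫⁻ y in ⋃ k, disjointed B k, ‖((l ^ 3 : ℝ) • K (l • (x - y))) • (g y - c)‖ₑ := by
        rw [hcover, setLIntegral_univ]
    _ ≤ ∑' k, ∫⁻ y in disjointed B k, ‖((l ^ 3 : ℝ) • K (l • (x - y))) • (g y - c)‖ₑ :=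
        lintegral_iUnion_le _ _
    _ ≤ ∑' k : ℕ, ENNReal.ofReal (16 * A) * V * O *
          ((1 + 9 * (k : ℝ≥0∞)) * ENNReal.ofReal ((1 / 2) ^ k)) := by
        refine ENNReal.tsum_le_tsum fun k => ?_
        calc ∫⁻ y in disjointed B k, ‖((l ^ 3 : ℝ) • K (l • (x - y))) • (g y - c)‖ₑ
            ≤ ∫⁻ y in disjointed B k,
                ENNReal.ofReal (l ^ 3 * (16 * A * (1 / 16) ^ k)) * ‖g y - c‖ₑ := by
              refine setLIntegral_mono' (MeasurableSet.disjointed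
                (fun k => Metric.isOpen_ball.measurableSet) k) fun y hy => ?_
              rw [enorm_smul]
              gcongr
              exact hker k y hy
          _ = ENNReal.ofReal (l ^ 3 * (16 * A * (1 / 16) ^ k)) *
                ∫⁻ y in disjointed B k, ‖g y - c‖ₑ :=
              lintegral_const_mul' _ _ ENNReal.ofReal_ne_top
          _ ≤ ENNReal.ofReal (l ^ 3 * (16 * A * (1 / 16) ^ k)) *
                (volume (B k) * ((1 + 9 * k) * O)) := by
              gcongr
              exact (lintegral_mono_set (disjointed_subset B k)).trans
                (h.lintegral_ball_le hg x hl' k)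
          _ = _ := by
              rw [volume_ball_eq x (by positivity)]
              have h9 : ENNReal.ofReal (l ^ 3 * (16 * A * (1 / 16) ^ k)) *
                  ENNReal.ofReal ((2 ^ k * l⁻¹) ^ 3) =
                  ENNReal.ofReal (16 * A) * ENNReal.ofReal ((1 / 2) ^ k) := by
                rw [← ENNReal.ofReal_mul (by positivity), ← ENNReal.ofReal_mul (by positivity)]
                congr 1
                have : ((1 : ℝ) / 16) ^ k * (2 ^ k) ^ 3 = (1 / 2) ^ k := by
                  rw [← pow_mul, mul_comm k 3, pow_mul, ← mul_pow]; norm_num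
                rw [← this, mul_pow, inv_pow]
                field_simp
              calc _ = ENNReal.ofReal (l ^ 3 * (16 * A * (1 / 16) ^ k)) *
                  ENNReal.ofReal ((2 ^ k * l⁻¹) ^ 3) * (V * ((1 + 9 * k) * O)) := by ring
                _ = _ := by rw [h9]; ring
    _ = _ := by rw [ENNReal.tsum_mul_left]; ring

theorem integral_fourierInv (m : 𝓢(R3, ℂ)) : ∫ x, (𝓕⁻ m : 𝓢(R3, ℂ)) x = m 0 := by
  have h : (𝓕 (𝓕⁻ m) : 𝓢(R3, ℂ)) 0 = m 0 := by rw [FourierTransform.fourier_fourierInv_eq]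
  rw [SchwartzMap.fourier_coe, Real.fourier_eq] at h
  simpa using h

/-- Multipliers whose symbol vanishes at the origin map `L² ∩ BMO` to `L^∞`, uniformly under
dilations. -/
theorem exists_lebesgueNorm_fieldMult_dilate_le_bmoNorm (m : 𝓢(R3, ℂ)) (hm : m 0 = 0) :
    ∃ C : ℝ≥0∞, C ≠ 0 ∧ C ≠ ⊤ ∧ ∀ (ι : Type) [Fintype ι] (l : ℝ) (hl : 0 < l) (v : L2Field ι),
      lebesgueNorm ⊤ (fieldMult (dilate l hl.ne' m) (fieldDist v)) ≤ C * bmoNorm (fieldDist v) := by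
  obtain ⟨C, hCt, hC⟩ := exists_lintegral_kernel_mul_le (𝓕⁻ m)
  have hC1 : C + 1 ≠ ⊤ := by simp [hCt]
  refine ⟨C + 1, by simp, hC1, fun ι _ l hl v => ?_⟩
  rw [bmoNorm]
  simp_rw [ENNReal.mul_iInf_of_ne (by simp : C + 1 ≠ 0) hC1]
  refine le_iInf fun g => le_iInf fun hg => ?_
  set O := ⨆ (x : R3) (r : ℝ) (_ : 0 < r),
      ⨍⁻ y in Metric.ball x r, ‖g y - (⨍ z in Metric.ball x r, g z ∂volume)‖ₑ ∂volume with hO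
  have hosc : MeanOscillationLE g O := fun x r hr => by
    rw [hO]
    exact le_iSup_of_le x (le_iSup₂_of_le r hr le_rfl)
  -- By uniqueness every representative is the given `L²` function almost everywhere, so the
  -- convolution converges absolutely.
  have hgm : MemLp g 2 volume :=
    (memLp_complexify v).ae_eq ((represents_fieldDist v).ae_eq hg)
  refine (hg.kernelConv one_le_two hgm (dilate l hl.ne' m)).lebesgueNorm_le.trans ?_
  rw [eLpNorm_exponent_top]
  refine essSup_le_of_ae_le ((C + 1) * O) (Eventually.of_forall fun x => ?_)
  set K : 𝓢(R3, ℂ) := 𝓕⁻ (dilate l hl.ne' m) with hK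
  have hKx : ∀ y, K (x - y) = (l ^ 3 : ℝ) • (𝓕⁻ m : 𝓢(R3, ℂ)) (l • (x - y)) := fun y =>
    fourierInv_dilate_apply hl m (x - y)
  set c := ⨍ z in Metric.ball x l⁻¹, g z ∂volume with hc
  have hint1 : Integrable (fun y => K (x - y)) volume := K.integrable.comp_sub_left x
  have hint2 : Integrable (fun y => K (x - y) • g y) volume := by
    have hKm : MemLp (fun y => K (x - y)) 2 volume :=
      (K.memLp 2 volume).comp_measurePreserving (Measure.measurePreserving_sub_left volume x)
    exact memLp_one_iff_integrable.1 (hgm.smul hKm)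
  -- The integral of the kernel is its symbol at `0`, so a constant may be subtracted from `g`.
  have hzero : ∫ y, K (x - y) • c = 0 := by
    rw [integral_smul_const, integral_sub_left_eq_self (fun y => K y), hK, integral_fourierInv,
      dilate_apply, smul_zero, hm, zero_smul]
  have hrep : HallMHD.kernelConv K g x = ∫ y, K (x - y) • (g y - c) := by
    simp_rw [smul_sub]
    rw [integral_sub hint2 (hint1.smul_const c), hzero, sub_zero]
    rfl
  change ‖HallMHD.kernelConv K g x‖ₑ ≤ (C + 1) * O
  rw [hrep]
  refine (enorm_integral_le_lintegral_enorm _).trans ?_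
  simp_rw [hKx]
  refine (hC ι g O hosc hgm.1 l hl x).trans ?_
  gcongr
  exact le_self_add

/-- For `j ≥ 0` the symbol vanishes at the origin. That of block `-1` equals `1` there, so this
block is treated separately. -/
theorem exists_lebesgueNorm_block_le_bmoNorm (hχ : IsCutoff χ) :
    ∃ C : ℝ≥0∞, C ≠ ⊤ ∧ ∀ (ι : Type) [Fintype ι] (j : ℤ) (_ : 0 ≤ j) (v : L2Field ι),
      lebesgueNorm ⊤ (block χ j (fieldDist v)) ≤ C * bmoNorm (fieldDist v) := by
  obtain ⟨C, -, hCt, hC⟩ := exists_lebesgueNorm_fieldMult_dilate_le_bmoNorm (baseSymbol hχ 0)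
    (by simp [baseSymbol])
  refine ⟨C, hCt, fun ι _ j hj v => ?_⟩
  rw [block_eq_fieldMult hχ (by omega), blockSymbol]
  have : baseSymbol hχ j = baseSymbol hχ 0 := by simp [baseSymbol, hj]
  rw [this]
  exact hC ι _ (zpow_two_pos j) v

/-! ### Thresholds, the common form of `Q1` and `Q2`. -/

/-- The least `q` such that `d p < κ` for all `p > q`. -/
noncomputable def threshold (d : ℤ → ℝ≥0∞) (κ : ℝ≥0∞) : ℕ∞ :=
  ⨅ (q : ℕ) (_ : ∀ p : ℤ, (q : ℤ) < p → d p < κ), (q : ℕ∞)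

/-- The defining condition is inherited by larger `q`, and an infimum below `n + 1` is witnessed by
some `q ≤ n`. -/
theorem threshold_le_iff {d : ℤ → ℝ≥0∞} {κ : ℝ≥0∞} {n : ℕ} :
    threshold d κ ≤ n ↔ ∀ p : ℤ, (n : ℤ) < p → d p < κ := by
  refine ⟨fun h p hp => ?_, fun h => iInf₂_le n h⟩
  have h1 : threshold d κ < (n + 1 : ℕ) := h.trans_lt (by exact_mod_cast Nat.lt_succ_self n)
  simp only [threshold, iInf_lt_iff] at h1
  obtain ⟨q, hq, hqn⟩ := h1
  have : q < n + 1 := by exact_mod_cast hqn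
  exact hq p (by omega)

theorem threshold_eq_iff {d : ℤ → ℝ≥0∞} {κ : ℝ≥0∞} {n : ℕ} :
    threshold d κ = n ↔ (∀ p : ℤ, (n : ℤ) < p → d p < κ) ∧
      ∀ m : ℕ, m < n → ¬ ∀ p : ℤ, (m : ℤ) < p → d p < κ := by
  simp_rw [← threshold_le_iff]
  refine ⟨fun h => ⟨h.le, fun m hm => ?_⟩, fun ⟨h1, h2⟩ => le_antisymm h1 ?_⟩
  · rw [h, not_le]; exact_mod_cast hm
  · by_contra hlt
    rw [not_le] at hlt
    lift threshold d κ to ℕ using (hlt.trans_le le_top).ne with q hq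
    exact h2 q (by exact_mod_cast hlt) le_rfl

/-- By minimality the condition fails for `n - 1` but holds beyond `n`, so it fails at index `n`
itself. -/
theorem le_of_threshold_eq {d : ℤ → ℝ≥0∞} {κ : ℝ≥0∞} {n : ℕ} (hn : 0 < n)
    (h : threshold d κ = n) : κ ≤ d n := by
  obtain ⟨h1, h2⟩ := threshold_eq_iff.1 h
  have h3 := h2 (n - 1) (by omega)
  by_contra hlt
  refine h3 fun p hp => ?_
  rcases eq_or_ne p n with rfl | hpn
  · exact not_le.1 hlt
  · exact h1 p (by omega)

theorem threshold_congr {d d' : ℤ → ℝ≥0∞} {κ : ℝ≥0∞} (h : ∀ p, 0 ≤ p → d p = d' p) :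
    threshold d κ = threshold d' κ := by
  unfold threshold
  have : ∀ q : ℕ, (∀ p : ℤ, (q : ℤ) < p → d p < κ) ↔ (∀ p : ℤ, (q : ℤ) < p → d' p < κ) :=
    fun q => forall₂_congr fun p hp => by rw [h p (by omega)]
  simp_rw [this]

theorem measurable_threshold {α : Type*} [MeasurableSpace α] {d : ℤ → α → ℝ≥0∞} (κ : ℝ≥0∞)
    (hd : ∀ p, Measurable (d p)) : Measurable fun t => threshold (fun p => d p t) κ := by
  rw [ENat.measurable_iff]
  intro n
  have hm : ∀ n : ℕ, MeasurableSet {t | ∀ p : ℤ, (n : ℤ) < p → d p t < κ} := fun n => by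
    simp only [ofPred_forall]
    exact MeasurableSet.iInter fun p => MeasurableSet.iInter fun _ =>
      measurableSet_lt (hd p) measurable_const
  have : (fun t => threshold (fun p => d p t) κ) ⁻¹' {(n : ℕ∞)} =
      {t | ∀ p : ℤ, (n : ℤ) < p → d p t < κ} ∩
        ⋂ (m : ℕ) (_ : m < n), {t | ∀ p : ℤ, (m : ℤ) < p → d p t < κ}ᶜ := by
    ext t
    simp only [mem_preimage, mem_singleton_iff, threshold_eq_iff, mem_inter_iff, mem_iInter,
      mem_compl_iff, mem_ofPred_eq]
  rw [this]
  exact (hm n).inter (MeasurableSet.iInter fun m => MeasurableSet.iInter fun _ => (hm m).compl)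

theorem lam_natCast (n : ℕ) : lam n = 2 ^ n := zpow_natCast _ _

theorem lam_zero : lam 0 = 1 := zpow_zero _

/-- If `λ_j^{-s} a_j ≤ N` and `d_j ≤ C₁ λ_j⁻¹ a_j`, then the threshold `Q` of `d` is finite and
`λ_j a_j ≤ C (1 + N^{2/(1-s)})` for `j ≤ Q`. -/
theorem exists_lam_mul_le_of_threshold {s : ℝ} (hs0 : 0 ≤ s) (hs1 : s < 1) {κ C₁ : ℝ≥0∞}
    (hκ : κ ≠ 0) (hκt : κ ≠ ⊤) (hC₁ : C₁ ≠ ⊤) :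
    ∃ C : ℝ≥0∞, C ≠ ⊤ ∧ ∀ (a d : ℤ → ℝ≥0∞) (N : ℝ≥0∞), N ≠ ⊤ →
      (∀ j, -1 ≤ j → lam j ^ (-s) * a j ≤ N) → (∀ j, 0 ≤ j → d j ≤ C₁ * (lam j)⁻¹ * a j) →
      threshold d κ ≠ ⊤ ∧ ∀ n : ℕ, threshold d κ = n → ∀ j : ℤ, -1 ≤ j → j ≤ n →
        lam j * a j ≤ C * (1 + N ^ (2 / (1 - s))) := by
  have hs : 0 < 1 - s := by linarith
  -- Raising `λ^{1-s}` to this power gives `λ^{1+s}`; the remaining factor `N` turns `r` into `r + 1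
  -- = 2/(1-s)`.
  set r := (1 + s) / (1 - s) with hr
  have hr0 : 0 ≤ r := by positivity
  have hr1 : 2 / (1 - s) = r + 1 := by rw [hr]; field_simp; ring
  have hr2 : 1 ≤ 2 / (1 - s) := by rw [hr1]; linarith
  refine ⟨1 + (C₁ / κ) ^ r, ENNReal.add_ne_top.2 ⟨by simp,
    ENNReal.rpow_ne_top_of_nonneg hr0 (ENNReal.div_ne_top hC₁ hκ)⟩, fun a d N hN ha hd => ?_⟩
  have ha' : ∀ j, -1 ≤ j → a j ≤ lam j ^ s * N := fun j hj => by
    calc a j = lam j ^ s * (lam j ^ (-s) * a j) := by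
          rw [← mul_assoc, ← ENNReal.rpow_add _ _ (lam_ne_zero j) (lam_ne_top j)]; simp
      _ ≤ _ := by gcongr; exact ha j hj
  have hd' : ∀ j, 0 ≤ j → d j ≤ C₁ * N * lam j ^ (s - 1) := fun j hj => by
    calc d j ≤ C₁ * (lam j)⁻¹ * (lam j ^ s * N) := (hd j hj).trans (by
          gcongr; exact ha' j (by omega))
      _ = C₁ * N * (lam j ^ s * lam j ^ (-1 : ℝ)) := by rw [ENNReal.rpow_neg_one]; ring
      _ = C₁ * N * lam j ^ (s - 1) := by
          rw [← ENNReal.rpow_add _ _ (lam_ne_zero j) (lam_ne_top j), ← sub_eq_add_neg]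
  constructor
  -- Finiteness of the threshold: the bound on `d` tends to `0` because `s < 1`.
  · have hlim : Tendsto (fun n : ℕ => C₁ * N * lam n ^ (s - 1)) atTop (𝓝 (C₁ * N * 0)) := by
      refine ENNReal.Tendsto.const_mul ?_ (Or.inr (ENNReal.mul_ne_top hC₁ hN))
      have h2 : (2 : ℝ≥0∞) ^ (s - 1) < 1 :=
        ENNReal.rpow_lt_one_of_one_lt_of_neg ENNReal.one_lt_two (by linarith)
      refine (ENNReal.tendsto_pow_atTop_nhds_zero_of_lt_one h2).congr fun n => ?_
      rw [lam_natCast, ← ENNReal.rpow_natCast, ← ENNReal.rpow_mul, ← ENNReal.rpow_natCast,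
        ← ENNReal.rpow_mul, mul_comm]
    rw [mul_zero] at hlim
    obtain ⟨n, hn⟩ := eventually_atTop.1 (hlim.eventually_lt_const (pos_iff_ne_zero.2 hκ))
    have hle : threshold d κ ≤ n := threshold_le_iff.2 fun p hp => by
      lift p to ℕ using (by omega)
      exact (hd' p (by omega)).trans_lt (hn p (by omega))
    exact (hle.trans_lt (ENat.natCast_lt_top n)).ne
  · intro n hn j hj hjn
    have h1 : lam j * a j ≤ lam n ^ (1 + s) * N := by
      calc lam j * a j ≤ lam j * (lam j ^ s * N) := by gcongr; exact ha' j hj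
        _ = lam j ^ (1 + s) * N := by
            rw [ENNReal.rpow_add _ _ (lam_ne_zero j) (lam_ne_top j), ENNReal.rpow_one, mul_assoc]
        _ ≤ lam n ^ (1 + s) * N := by
            gcongr
            exact lam_mono hjn
    refine h1.trans ?_
    have hN1 : N ≤ 1 + N ^ (2 / (1 - s)) := by
      rcases le_total N 1 with h | h
      · exact h.trans le_self_add
      · calc N = N ^ (1 : ℝ) := (ENNReal.rpow_one N).symm
          _ ≤ N ^ (2 / (1 - s)) := ENNReal.rpow_le_rpow_of_exponent_le h hr2
          _ ≤ _ := le_add_self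
    -- At `n = 0` minimality gives no lower bound on `d`, but `λ_0 = 1` and `N` alone suffices;
    -- hence the `1 +` in the estimate.
    rcases Nat.eq_zero_or_pos n with rfl | hpos
    · rw [Nat.cast_zero, lam_zero, ENNReal.one_rpow, one_mul]
      exact hN1.trans (le_mul_of_one_le_left' le_self_add)
    · have h2 : κ ≤ C₁ * N * lam n ^ (s - 1) :=
        (le_of_threshold_eq hpos hn).trans (hd' n (by omega))
      have h3 : lam n ^ (1 - s) ≤ C₁ / κ * N := by
        have h4 : κ * lam n ^ (1 - s) ≤ C₁ * N := by
          calc κ * lam n ^ (1 - s) ≤ C₁ * N * lam n ^ (s - 1) * lam n ^ (1 - s) := by gcongr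
            _ = C₁ * N := by
              rw [mul_assoc, ← ENNReal.rpow_add _ _ (lam_ne_zero n) (lam_ne_top n)]
              simp
        rw [div_eq_mul_inv, mul_right_comm, ← div_eq_mul_inv,
          ENNReal.le_div_iff_mul_le (Or.inl hκ) (Or.inl hκt), mul_comm]
        exact h4
      have h5 : lam n ^ (1 + s) ≤ (C₁ / κ) ^ r * N ^ r := by
        rw [← ENNReal.mul_rpow_of_nonneg _ _ hr0]
        calc lam n ^ (1 + s) = (lam n ^ (1 - s)) ^ r := by
              rw [← ENNReal.rpow_mul, hr, mul_div_cancel₀ _ hs.ne']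
          _ ≤ _ := by gcongr
      calc lam n ^ (1 + s) * N ≤ (C₁ / κ) ^ r * N ^ r * N := by gcongr
        _ = (C₁ / κ) ^ r * N ^ (2 / (1 - s)) := by
            rw [hr1, ENNReal.rpow_add_of_nonneg _ _ hr0 zero_le_one, ENNReal.rpow_one, mul_assoc]
        _ ≤ _ := by
            gcongr
            · exact le_add_self
            · exact le_add_self

/-! ### Measurability in time. -/

theorem continuous_lebesgueNorm_block (hχ : IsCutoff χ) {j : ℤ} (hj : -1 ≤ j) :
    Continuous fun v : L2Field ι => lebesgueNorm ⊤ (block χ j (fieldDist v)) := by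
  simp_rw [block_eq_fieldMult hχ hj]
  exact continuous_lebesgueNorm_fieldMult _

/-- For fixed `Q` the composition is again a single multiplier with Schwartz symbol. -/
theorem continuous_lebesgueNorm_block_lowFreq (hχ : IsCutoff χ) {j : ℤ} (hj : -1 ≤ j) (Q : ℕ∞) :
    Continuous fun v : L2Field ι => lebesgueNorm ⊤ (block χ j (lowFreq χ Q (fieldDist v))) := by
  cases Q with
  | top => exact continuous_lebesgueNorm_block hχ hj
  | coe n =>
    set M : 𝓢(R3, ℂ) := ∑ k ∈ Finset.Icc (-1 : ℤ) n, blockSymbol hχ k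
    have h1 : ∀ T : DistField ι, lowFreq χ n T = fieldMult M T := by
      intro T
      funext i
      have hM : (M : R3 → ℂ) = fun ξ => ∑ k ∈ Finset.Icc (-1 : ℤ) n, blockSymbol hχ k ξ := by
        ext ξ; simp [M]
      have := congrArg (fun L => L (T i)) (TemperedDistribution.fourierMultiplierCLM_sum ℂ
        (s := Finset.Icc (-1 : ℤ) n) (fun k _ => (blockSymbol hχ k).hasTemperateGrowth))
      rw [fieldMult, hM]
      simp only [sum_apply] at this
      rw [this]
      refine Finset.sum_congr rfl fun k hk => ?_
      rw [block_eq_fieldMult hχ (Finset.mem_Icc.1 hk).1]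
      rfl
    have h2 : ∀ T : DistField ι, block χ j (lowFreq χ n T) =
        fieldMult (SchwartzMap.pairing (ContinuousLinearMap.mul ℂ ℂ) M (blockSymbol hχ j)) T := by
      intro T
      rw [h1, block_eq_fieldMult hχ hj, fieldMult_fieldMult M.hasTemperateGrowth
        (blockSymbol hχ j).hasTemperateGrowth]
      congr 1
    simp_rw [h2]
    exact continuous_lebesgueNorm_fieldMult _

theorem measurable_besovNorm_lowFreq {α : Type*} [MeasurableSpace α] (hχ : IsCutoff χ) (s : ℝ)
    (Q : ℕ∞) {g : α → L2Field ι} (hg : StronglyMeasurable g) :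
    Measurable fun t => besovNorm χ s ⊤ (lowFreq χ Q (fieldDist (g t))) :=
  Measurable.iSup fun _ => Measurable.iSup fun hq =>
    (((continuous_lebesgueNorm_block_lowFreq hχ hq Q).comp_stronglyMeasurable
      hg).measurable).const_mul _

theorem aemeasurable_besovNorm {α : Type*} [MeasurableSpace α] {μ : Measure α} (hχ : IsCutoff χ)
    (s : ℝ) {g : α → L2Field ι} (hg : AEStronglyMeasurable g μ) :
    AEMeasurable (fun t => besovNorm χ s ⊤ (fieldDist (g t))) μ :=
  ⟨_, measurable_besovNorm_lowFreq hχ s ⊤ hg.stronglyMeasurable_mk, by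
    filter_upwards [hg.ae_eq_mk] with t ht
    rw [ht]
    rfl⟩

/-- Applied with `β = ℕ∞`, where the truncation level itself depends on time. -/
theorem measurable_apply_of_countable {α β γ : Type*} [MeasurableSpace α] [MeasurableSpace β]
    [MeasurableSpace γ] [Countable β] [MeasurableSingletonClass β] {F : β → α → γ}
    (hF : ∀ Q, Measurable (F Q)) {θ : α → β} (hθ : Measurable θ) :
    Measurable fun t => F (θ t) t :=
  (measurable_from_prod_countable_right (f := fun z : β × α => F z.1 z.2) hF).comp
    (hθ.prodMk measurable_id)

theorem aemeasurable_besovNorm_lowFreq_threshold {α : Type*} [MeasurableSpace α] {μ : Measure α}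
    (hχ : IsCutoff χ) (s : ℝ) (κ : ℝ≥0∞) {g : α → L2Field ι} (hg : AEStronglyMeasurable g μ)
    {d : ℤ → α → ℝ≥0∞} (hd : ∀ p, 0 ≤ p → AEMeasurable (d p) μ) :
    AEMeasurable (fun t => besovNorm χ s ⊤
      (lowFreq χ (threshold (fun p => d p t) κ) (fieldDist (g t)))) μ := by
  -- Negative indices never enter a threshold, so any measurable function serves there.
  have h : ∀ p, ∃ d' : α → ℝ≥0∞, Measurable d' ∧ (0 ≤ p → d p =ᵐ[μ] d') := fun p => by
    by_cases hp : 0 ≤ p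
    · exact ⟨_, (hd p hp).measurable_mk, fun _ => (hd p hp).ae_eq_mk⟩
    · exact ⟨0, measurable_zero, fun h => absurd h hp⟩
  choose d' hd' hdd' using h
  refine ⟨fun t => besovNorm χ s ⊤
    (lowFreq χ (threshold (fun p => d' p t) κ) (fieldDist (hg.mk g t))), ?_, ?_⟩
  · exact measurable_apply_of_countable
      (F := fun Q t => besovNorm χ s ⊤ (lowFreq χ Q (fieldDist (hg.mk g t))))
      (fun Q => measurable_besovNorm_lowFreq hχ s Q hg.stronglyMeasurable_mk)
      (measurable_threshold κ hd')
  · have hall : ∀ᵐ t ∂μ, ∀ p, 0 ≤ p → d p t = d' p t :=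
      ae_all_iff.2 fun p => by
        by_cases hp : 0 ≤ p
        · filter_upwards [hdd' p hp] with t ht _ using ht
        · exact Eventually.of_forall fun t h => absurd h hp
    filter_upwards [hall, hg.ae_eq_mk] with t ht hgt
    rw [threshold_congr ht, ← hgt]

/-! ### Integrability of the low modes. -/

/-- The contribution of one field to the low modes criterion. -/
theorem lowModes_field {α : Type*} [MeasurableSpace α] {μ : Measure α} [IsFiniteMeasure μ]
    (hχ : IsCutoff χ) {s : ℝ} (hs0 : 0 ≤ s) (hs1 : s < 1) {κ C₁ : ℝ≥0∞} (hκ : κ ≠ 0) (hκt : κ ≠ ⊤)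
    (hC₁ : C₁ ≠ ⊤) {g : α → L2Field ι} (hg : AEStronglyMeasurable g μ)
    {d : ℤ → α → ℝ≥0∞}
    (hdle : ∀ᵐ t ∂μ, ∀ j, 0 ≤ j →
      d j t ≤ C₁ * (lam j)⁻¹ * lebesgueNorm ⊤ (block χ j (fieldDist (g t))))
    (hN : ∫⁻ t, besovNorm χ (-s) ⊤ (fieldDist (g t)) ^ (2 / (1 - s)) ∂μ < ⊤) :
    (∀ᵐ t ∂μ, threshold (fun p => d p t) κ ≠ ⊤) ∧
      ∫⁻ t, besovNorm χ 1 ⊤ (lowFreq χ (threshold (fun p => d p t) κ) (fieldDist (g t))) ∂μ < ⊤ := by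
  obtain ⟨C, hCt, hC⟩ := exists_lam_mul_le_of_threshold hs0 hs1 hκ hκt hC₁
  obtain ⟨D, hDt, hD⟩ := exists_besovNorm_lowFreq_le hχ
  have hr : 0 < 2 / (1 - s) := by
    have : 0 < 1 - s := by linarith
    positivity
  have hfin : ∀ᵐ t ∂μ, besovNorm χ (-s) ⊤ (fieldDist (g t)) ≠ ⊤ := by
    filter_upwards [ae_lt_top' ((aemeasurable_besovNorm hχ (-s) hg).pow_const _) hN.ne] with t ht h
    rw [h, ENNReal.top_rpow_of_pos hr] at ht
    exact lt_irrefl _ ht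
  have key : ∀ᵐ t ∂μ, threshold (fun p => d p t) κ ≠ ⊤ ∧
      besovNorm χ 1 ⊤ (lowFreq χ (threshold (fun p => d p t) κ) (fieldDist (g t))) ≤
        D * C * (1 + besovNorm χ (-s) ⊤ (fieldDist (g t)) ^ (2 / (1 - s))) := by
    filter_upwards [hfin, hdle] with t ht hdt
    obtain ⟨h1, h2⟩ := hC (fun j => lebesgueNorm ⊤ (block χ j (fieldDist (g t))))
      (fun p => d p t) _ ht (fun j hj => le_iSup₂_of_le (f := fun (q : ℤ) (_ : -1 ≤ q) =>
        lam q ^ (-s) * lebesgueNorm ⊤ (block χ q (fieldDist (g t)))) j hj le_rfl) hdt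
    refine ⟨h1, ?_⟩
    obtain ⟨n, hn⟩ := ENat.ne_top_iff_exists.1 h1
    rw [← hn, mul_assoc]
    exact hD ι n _ _ (h2 n hn.symm)
  refine ⟨key.mono fun t h => h.1, (lintegral_mono_ae (key.mono fun t h => h.2)).trans_lt ?_⟩
  rw [lintegral_const_mul' _ _ (ENNReal.mul_ne_top hDt hCt), lintegral_add_left measurable_const,
    lintegral_const, one_mul]
  exact ENNReal.mul_lt_top (ENNReal.mul_lt_top hDt.lt_top hCt.lt_top)
    (ENNReal.add_lt_top.2 ⟨measure_lt_top _ _, hN⟩)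

/-- The low modes criterion follows from subcritical Besov bounds. -/
theorem lowModesIntegrable_of_lintegral_lt_top (hχ : IsCutoff χ) {κ T : ℝ} (hκ : 0 < κ)
    {u b : ℝ → L2Field (Fin 3)} {gb : ℝ → L2Field (Fin 3 × Fin 3)}
    (hu : AEStronglyMeasurable u (volume.restrict (Ioo 0 T)))
    (hb : AEStronglyMeasurable b (volume.restrict (Ioo 0 T)))
    (hgb : AEStronglyMeasurable gb (volume.restrict (Ioo 0 T)))
    (hgrad : ∀ᵐ t ∂(volume.restrict (Ioo 0 T)), fieldDist (gb t) = gradDist (fieldDist (b t)))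
    {s σ : ℝ} (hs0 : 0 ≤ s) (hs1 : s < 1) (hσ0 : 0 ≤ σ) (hσ1 : σ < 1)
    (hN : ∫⁻ t in Ioo 0 T, besovNorm χ (-s) ⊤ (fieldDist (u t)) ^ (2 / (1 - s)) < ⊤)
    (hM : ∫⁻ t in Ioo 0 T, besovNorm χ (-σ) ⊤ (fieldDist (gb t)) ^ (2 / (1 - σ)) < ⊤) :
    LowModesIntegrable χ κ T u b := by
  have : IsFiniteMeasure (volume.restrict (Ioo (0 : ℝ) T)) := ⟨by simp⟩
  have hκ0 : ENNReal.ofReal κ ≠ 0 := by simpa using hκ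
  obtain ⟨C, hCt, hC⟩ := exists_lebesgueNorm_block_le_gradDist hχ
  have hdu : ∀ p : ℤ, 0 ≤ p → AEMeasurable
      (fun t => (lam p)⁻¹ * lebesgueNorm ⊤ (block χ p (fieldDist (u t))))
      (volume.restrict (Ioo 0 T)) := fun p hp =>
    (((continuous_lebesgueNorm_block hχ (by omega)).comp_aestronglyMeasurable
      hu).aemeasurable).const_mul _
  have hdb : ∀ p : ℤ, 0 ≤ p → AEMeasurable
      (fun t => lebesgueNorm ⊤ (block χ p (fieldDist (b t))))
      (volume.restrict (Ioo 0 T)) := fun p hp =>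
    ((continuous_lebesgueNorm_block hχ (by omega)).comp_aestronglyMeasurable hb).aemeasurable
  obtain ⟨hu1, hu2⟩ := lowModes_field hχ hs0 hs1 hκ0 ENNReal.ofReal_ne_top ENNReal.one_ne_top hu
    (d := fun p t => (lam p)⁻¹ * lebesgueNorm ⊤ (block χ p (fieldDist (u t))))
    (Eventually.of_forall fun t j hj => by rw [one_mul]) hN
  -- The field is `∇b` while the threshold is that of `b`; the inverse Bernstein inequality links
  -- them.
  obtain ⟨hb1, hb2⟩ := lowModes_field hχ hσ0 hσ1 hκ0 ENNReal.ofReal_ne_top hCt hgb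
    (d := fun p t => lebesgueNorm ⊤ (block χ p (fieldDist (b t))))
    (hgrad.mono fun t ht j hj => by rw [ht]; exact hC j hj _) hM
  have hmu := aemeasurable_besovNorm_lowFreq_threshold hχ 1 (ENNReal.ofReal κ) hu hdu
  have hmb := aemeasurable_besovNorm_lowFreq_threshold hχ 1 (ENNReal.ofReal κ) hgb hdb
  have heq : lowModes χ κ u b =ᵐ[volume.restrict (Ioo 0 T)] fun t =>
      besovNorm χ 1 ⊤ (lowFreq χ (threshold (fun p => (lam p)⁻¹ *
        lebesgueNorm ⊤ (block χ p (fieldDist (u t)))) (ENNReal.ofReal κ)) (fieldDist (u t))) +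
      besovNorm χ 1 ⊤ (lowFreq χ (threshold (fun p =>
        lebesgueNorm ⊤ (block χ p (fieldDist (b t)))) (ENNReal.ofReal κ)) (fieldDist (gb t))) := by
    filter_upwards [hgrad] with t ht
    rw [lowModes, gradDist_lowFreq hχ, ← ht]
    rfl
  refine ⟨hu1.and hb1, (hmu.add hmb).aestronglyMeasurable.congr heq.symm, ?_⟩
  rw [HasFiniteIntegral]
  simp only [enorm_eq_self]
  rw [lintegral_congr_ae heq, lintegral_add_left' hmu]
  exact ENNReal.add_lt_top.2 ⟨hu2, hb2⟩

/-! ### Time exponents and embeddings into Besov spaces. -/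

theorem toReal_three_div_lt_one {p : ℝ≥0∞} (hp : 3 < p) : (3 / p).toReal < 1 := by
  have h : 3 / p < 1 := by
    rw [ENNReal.div_lt_iff (Or.inl (pos_of_gt hp).ne') (Or.inr (by simp)), one_mul]
    exact hp
  exact (ENNReal.toReal_lt_toReal h.ne_top ENNReal.one_ne_top).2 h

/-- The exponent `2 / (1 - s)` is at most `q` if `s + 2 / q ≤ 1`. -/
theorem ofReal_two_div_le {a q : ℝ≥0∞} (h : a + 2 / q ≤ 1) (ha : a.toReal < 1) :
    ENNReal.ofReal (2 / (1 - a.toReal)) ≤ q := by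
  have hat : a ≠ ⊤ := (le_self_add.trans h).trans_lt ENNReal.one_lt_top |>.ne
  have hqt : 2 / q ≠ ⊤ := (le_add_self.trans h).trans_lt ENNReal.one_lt_top |>.ne
  rcases eq_or_ne q ⊤ with rfl | hq
  · exact le_top
  have hq0 : q ≠ 0 := by
    rintro rfl
    exact hqt (ENNReal.div_zero two_ne_zero)
  have hqpos : 0 < q.toReal := ENNReal.toReal_pos hq0 hq
  have h1 := ENNReal.toReal_mono ENNReal.one_ne_top h
  rw [ENNReal.toReal_add hat hqt, ENNReal.toReal_div] at h1
  simp only [ENNReal.toReal_ofNat, ENNReal.toReal_one] at h1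
  refine ENNReal.ofReal_le_of_le_toReal ?_
  rw [div_le_iff₀ (by linarith)]
  have h2 : 2 / q.toReal ≤ 1 - a.toReal := by linarith
  rw [div_le_iff₀ hqpos] at h2
  linarith

/-- Finite measure allows the time exponent to be lowered from `q` to `r`, including from `q = ∞`.
-/
theorem lintegral_rpow_lt_top_of_memLp {α : Type*} [MeasurableSpace α] {μ : Measure α}
    [IsFiniteMeasure μ] {N : α → ℝ≥0∞} {q : ℝ≥0∞} (hN : MemLp N q μ) {r : ℝ} (hr : 0 < r)
    (hrq : ENNReal.ofReal r ≤ q) : ∫⁻ t, N t ^ r ∂μ < ⊤ := by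
  have h := (hN.mono_exponent hrq).2
  rw [eLpNorm_lt_top_iff_lintegral_rpow_enorm_lt_top (by simpa using hr) ENNReal.ofReal_ne_top,
    ENNReal.toReal_ofReal hr.le] at h
  simpa only [enorm_eq_self] using h

/-- Embedding of `L^p` into `B^{-3/p}_{∞,∞}`. -/
theorem exists_besovNorm_le_lebesgueNorm (hχ : IsCutoff χ) {p : ℝ≥0∞} (hp : 1 ≤ p) :
    ∃ C : ℝ≥0∞, C ≠ ⊤ ∧ ∀ (ι : Type) [Fintype ι] (T : DistField ι),
      besovNorm χ (-(3 / p).toReal) ⊤ T ≤ C * lebesgueNorm p T := by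
  obtain ⟨C, -, hCt, hC⟩ := exists_lebesgueNorm_block_le hχ hp
  refine ⟨C, hCt, fun ι _ T => iSup₂_le fun j hj => ?_⟩
  calc lam j ^ (-(3 / p).toReal) * lebesgueNorm ⊤ (block χ j T)
      ≤ lam j ^ (-(3 / p).toReal) * (C * lam j ^ (3 / p).toReal * lebesgueNorm p T) := by
        gcongr
        exact hC ι j hj T
    _ = lam j ^ (-(3 / p).toReal) * lam j ^ (3 / p).toReal * (C * lebesgueNorm p T) := by ring
    _ = C * lebesgueNorm p T := by
        rw [← ENNReal.rpow_add _ _ (lam_ne_zero j) (lam_ne_top j)]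
        simp

/-- Embedding of `L² ∩ BMO` into `B^0_{∞,∞}`. -/
theorem exists_besovNorm_le_bmoNorm (hχ : IsCutoff χ) :
    ∃ C : ℝ≥0∞, C ≠ ⊤ ∧ ∀ (ι : Type) [Fintype ι] (v : L2Field ι),
      besovNorm χ (-0) ⊤ (fieldDist v) ≤ C * (bmoNorm (fieldDist v) + ‖v‖ₑ) := by
  obtain ⟨C, hCt, hC⟩ := exists_lebesgueNorm_block_le_bmoNorm hχ
  obtain ⟨D, -, hDt, hD⟩ := exists_lebesgueNorm_block_le hχ (p := 2) one_le_two
  refine ⟨C + D * lam (-1) ^ (3 / 2 : ℝ≥0∞).toReal, ENNReal.add_ne_top.2 ⟨hCt,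
    ENNReal.mul_ne_top hDt (ENNReal.rpow_ne_top_of_nonneg ENNReal.toReal_nonneg (lam_ne_top _))⟩,
    fun ι _ v => iSup₂_le fun j hj => ?_⟩
  rw [neg_zero, ENNReal.rpow_zero, one_mul]
  -- Blocks `j ≥ 0` use the BMO seminorm, block `-1` Bernstein's inequality from `L²`.
  rcases le_or_gt 0 j with h | h
  · refine (hC ι j h v).trans ?_
    gcongr
    · exact le_self_add
    · exact le_self_add
  · obtain rfl : j = -1 := by omega
    refine (hD ι (-1) le_rfl _).trans ?_
    gcongr
    · exact le_add_self
    · refine (lebesgueNorm_fieldDist_le v 2).trans ?_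
      rw [← Lp.enorm_def]
      exact le_add_self

theorem lintegral_besovNorm_lt_top_of_lebesgueNorm {α : Type*} [MeasurableSpace α] {μ : Measure α}
    [IsFiniteMeasure μ] (hχ : IsCutoff χ) {p q : ℝ≥0∞} (hp : 3 < p) (hpq : 3 / p + 2 / q ≤ 1)
    {S : α → DistField ι} (hS : MemLp (fun t => lebesgueNorm p (S t)) q μ) :
    ∫⁻ t, besovNorm χ (-(3 / p).toReal) ⊤ (S t) ^ (2 / (1 - (3 / p).toReal)) ∂μ < ⊤ := by
  have hs1 := toReal_three_div_lt_one hp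
  have hr : 0 < 2 / (1 - (3 / p).toReal) := div_pos two_pos (by linarith)
  obtain ⟨C, hCt, hC⟩ := exists_besovNorm_le_lebesgueNorm hχ (p := p)
    (le_trans (by norm_num) hp.le)
  have hCr := ENNReal.rpow_ne_top_of_nonneg hr.le hCt
  calc ∫⁻ t, besovNorm χ (-(3 / p).toReal) ⊤ (S t) ^ (2 / (1 - (3 / p).toReal)) ∂μ
      ≤ ∫⁻ t, C ^ (2 / (1 - (3 / p).toReal)) *
          lebesgueNorm p (S t) ^ (2 / (1 - (3 / p).toReal)) ∂μ := by
        refine lintegral_mono fun t => ?_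
        rw [← ENNReal.mul_rpow_of_nonneg _ _ hr.le]
        gcongr
        exact hC ι (S t)
    _ < ⊤ := by
        rw [lintegral_const_mul' _ _ hCr]
        exact ENNReal.mul_lt_top hCr.lt_top
          (lintegral_rpow_lt_top_of_memLp hS hr (ofReal_two_div_le hpq hs1))

/-- The case `s = 0`, exponent `2`; `-0` and `1 - 0` are kept to match
`lowModesIntegrable_of_lintegral_lt_top`. -/
theorem lintegral_besovNorm_lt_top_of_bmoNorm {α : Type*} [MeasurableSpace α] {μ : Measure α}
    [IsFiniteMeasure μ] (hχ : IsCutoff χ) {g : α → L2Field ι} (hg : MemLp g 2 μ)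
    (hS : MemLp (fun t => bmoNorm (fieldDist (g t))) 2 μ) :
    ∫⁻ t, besovNorm χ (-0) ⊤ (fieldDist (g t)) ^ (2 / (1 - 0) : ℝ) ∂μ < ⊤ := by
  obtain ⟨C, hCt, hC⟩ := exists_besovNorm_le_bmoNorm hχ
  have hr : (0 : ℝ) < 2 / (1 - 0) := by norm_num
  have hCr := ENNReal.rpow_ne_top_of_nonneg hr.le hCt
  have hsum : MemLp (fun t => bmoNorm (fieldDist (g t)) + ‖g t‖ₑ) 2 μ := hS.add hg.enorm
  calc ∫⁻ t, besovNorm χ (-0) ⊤ (fieldDist (g t)) ^ (2 / (1 - 0) : ℝ) ∂μ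
      ≤ ∫⁻ t, C ^ (2 / (1 - 0) : ℝ) *
          (bmoNorm (fieldDist (g t)) + ‖g t‖ₑ) ^ (2 / (1 - 0) : ℝ) ∂μ := by
        refine lintegral_mono fun t => ?_
        rw [← ENNReal.mul_rpow_of_nonneg _ _ hr.le]
        gcongr
        exact hC ι (g t)
    _ < ⊤ := by
        rw [lintegral_const_mul' _ _ hCr]
        exact ENNReal.mul_lt_top hCr.lt_top
          (lintegral_rpow_lt_top_of_memLp hsum hr (by simp))

end HallMHD

open HallMHD
theorem lemma3p1
    (χ : R3 → ℝ) (hχ : IsCutoff χ)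
    (ν μ c₀ T : ℝ) (hν : 0 < ν) (hμ : 0 < μ) (hc₀ : 0 < c₀) (hT : 0 < T)
    (u₀ b₀ : L2Field (Fin 3)) (u b : ℝ → L2Field (Fin 3))
    (hsol : IsWeakSolution ν μ T u₀ b₀ u b) :
    (∀ q p γ β : ℝ≥0∞, 2 ≤ q → 3 < p → 2 ≤ γ → 3 < β →
        2 / q + 3 / p = 1 → 2 / γ + 3 / β = 1 →
        InLq T q (fun t => besovNorm χ (-(3 / p).toReal) ⊤ (fieldDist (u t))) →
        InLq T γ (fun t => besovNorm χ (-(3 / β).toReal) ⊤ (gradDist (fieldDist (b t)))) →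
        LowModesIntegrable χ (c₀ * min ν μ) T u b) ∧
    (∀ q p γ β : ℝ≥0∞, 3 < p → 3 < β →
        3 / p + 2 / q ≤ 1 → 3 / β + 2 / γ ≤ 1 →
        InLq T q (fun t => lebesgueNorm p (fieldDist (u t))) →
        InLq T γ (fun t => lebesgueNorm β (gradDist (fieldDist (b t)))) →
        LowModesIntegrable χ (c₀ * min ν μ) T u b) ∧
    (InLq T 2 (fun t => bmoNorm (fieldDist (u t))) →
        InLq T 2 (fun t => bmoNorm (gradDist (fieldDist (b t)))) →
        LowModesIntegrable χ (c₀ * min ν μ) T u b) := by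
  obtain ⟨-, -, -, -, -, gu, gb, hu, hb, -⟩ := hsol
  have hκ : 0 < c₀ * min ν μ := mul_pos hc₀ (lt_min hν hμ)
  have : IsFiniteMeasure (volume.restrict (Ioo (0 : ℝ) T)) := ⟨by simp⟩
  have hgrad := hb.grad_eq
  have core := fun {s σ : ℝ} => lowModesIntegrable_of_lintegral_lt_top (s := s) (σ := σ) hχ hκ
    hu.memL2.1 hb.memL2.1 hb.memL2_grad.1 hgrad
  have hpos : ∀ {p : ℝ≥0∞}, 3 < p → 0 < 2 / (1 - (3 / p).toReal) := fun hp =>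
    div_pos two_pos (by linarith [toReal_three_div_lt_one hp])
  refine ⟨fun q p γ β _ hp _ hβ hqp hγβ hU hB => ?_, fun q p γ β hp hβ hqp hγβ hU hB => ?_,
    fun hU hB => ?_⟩
  · refine core ENNReal.toReal_nonneg (toReal_three_div_lt_one hp) ENNReal.toReal_nonneg
      (toReal_three_div_lt_one hβ)
      (lintegral_rpow_lt_top_of_memLp hU (hpos hp)
        (ofReal_two_div_le (add_comm (2 / q) _ ▸ hqp.le) (toReal_three_div_lt_one hp))) ?_
    -- For almost every time `∇b` is the distribution of the `L²` field `gb`, so the two norms agree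
    -- under the integral.
    rw [lintegral_congr_ae (hgrad.mono fun t ht => by rw [ht])]
    exact lintegral_rpow_lt_top_of_memLp hB (hpos hβ)
      (ofReal_two_div_le (add_comm (2 / γ) _ ▸ hγβ.le) (toReal_three_div_lt_one hβ))
  · refine core ENNReal.toReal_nonneg (toReal_three_div_lt_one hp) ENNReal.toReal_nonneg
      (toReal_three_div_lt_one hβ) (lintegral_besovNorm_lt_top_of_lebesgueNorm hχ hp hqp hU) ?_
    rw [lintegral_congr_ae (hgrad.mono fun t ht => by rw [ht])]
    exact lintegral_besovNorm_lt_top_of_lebesgueNorm hχ hβ hγβ hB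
  · refine core le_rfl one_pos le_rfl one_pos
      (lintegral_besovNorm_lt_top_of_bmoNorm hχ hu.memL2 hU)
      (lintegral_besovNorm_lt_top_of_bmoNorm hχ hb.memL2_grad ?_)
    exact hB.ae_eq (hgrad.mono fun t ht => by simp only [ht])
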